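/- **Setting.** Let $d\in\mathbb N$. For $x,\xi,t\in\mathbb R^n$ and $\tau\in\mathbb R$ put $\rho(x,\xi;\tau)u(t)=e^{2\pi i\tau}e^{-\pi i\,\xi\cdot x}e^{2\pi i\,\xi\cdot t}u(t-x)$ for $u\in L^2(\mathbb R^n)$. The group $Sp(n,\mathbb R)$ consists of the real $2n\times 2n$ matrices $A$ with $A^{T}JA=J$, where $J=\begin{pmatrix}0&I\\-I&0\end{pmatrix}$. For $\mathcal A\in Sp(n,\mathbb R)$, a metaplectic operator with projection $\mathcal A$ is a unitary operator $\hat{\mathcal A}$ on $L^2(\mathbb R^n)$ with $\hat{\mathcal A}\,\rho(z;\tau)\,\hat{\mathcal A}^{-1}=\rho(\mathcal Az;\tau)$ for all $z\in\mathbb R^{2n}$, $\tau\in\mathbb R$ (it is determined by $\mathcal A$ up to a factor of modulus one). It maps $\mathcal S(\mathbb R^n)$ continuously onto itself and acts on $\mathcal S'(\mathbb R^n)$ by $\langle\hat{\mathcal A}b,\varphi\rangle=\langle b,\hat{\mathcal A}^{-1}\varphi\rangle$, $\varphi\in\mathcal S(\mathbb R^n)$. Here $\langle b,\varphi\rangle$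 is linear in $b$, conjugate-linear in $\varphi$, and extends $\int b\,\overline{\varphi}$. Let $\mathcal A\in Sp(2d,\mathbb R)$ and let $\hat{\mathcal A}$ be any metaplectic operator on $L^2(\mathbb R^{2d})$ with projection $\mathcal A$. For $f,g\in\mathcal S(\mathbb R^d)$ and $b\in\mathcal S'(\mathbb R^{2d})$ let $W_{\mathcal A}(f,g)=\hat{\mathcal A}(f\otimes\overline g)$, and let $\operatorname{Op}_{\mathcal A}(b):\mathcal S(\mathbb R^d)\to\mathcal S'(\mathbb R^d)$ be the operator with $\langle\operatorname{Op}_{\mathcal A}(b)f,g\rangle=\langle b,W_{\mathcal A}(g,f)\rangle$ for all $f,g\in\mathcal S(\mathbb R^d)$. For $a\in\mathcal S'(\mathbb R^{2d})$ and $\varphi_1,\varphi_2\in\mathcal S(\mathbb R^d)$ the $\mathcal A$-localization operator is $$A_{a,\mathcal A}^{\varphi_1,\varphi_2}=\operatorname{Op}_{\mathcal A}\bigl(a*W_{\mathcal A}(\varphi_2,\varphi_1)\bigr):\mathcal S(\mathbb R^d)\to\mathcal S'(\mathbb R^d),$$ where $*$ is the convolution of a tempered distribution with a Schwartz function. Let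 $W(f,g)(x,\xi)=\int_{\mathbb R^d}f(x+\tfrac t2)\overline{g(x-\tfrac t2)}e^{-2\pi i t\cdot\xi}\,dt$ be the cross-Wigner distribution, and for $\sigma\in\mathcal S'(\mathbb R^{2d})$ let the Weyl operator $\operatorname{Op}_w(\sigma):\mathcal S(\mathbb R^d)\to\mathcal S'(\mathbb R^d)$ be given by $\langle\operatorname{Op}_w(\sigma)f,g\rangle=\langle\sigma,W(g,f)\rangle$. A Weyl symbol of an operator $T:\mathcal S(\mathbb R^d)\to\mathcal S'(\mathbb R^d)$ is a $\sigma\in\mathcal S'(\mathbb R^{2d})$ with $T=\operatorname{Op}_w(\sigma)$. Finally, let $\hat{\mathcal A}_{1/2}$ be the metaplectic operator on $L^2(\mathbb R^{2d})$ with projection $$\mathcal A_{1/2}=\begin{pmatrix}\frac12I&\frac12I&0&0\\0&0&\frac12I&-\frac12I\\0&0&I&I\\-I&I&0&0\end{pmatrix}\in Sp(2d,\mathbb R)$$ ($d\times d$ blocks) that is normalised by $\hat{\mathcal A}_{1/2}(f\otimes\overline g)=W(f,g)$ for all $f,g\in\mathcal S(\mathbb R^d)$. **Proposition.** Let $\mathcal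 A\in Sp(2d,\mathbb R)$, $\varphi_1,\varphi_2\in\mathcal S(\mathbb R^d)$ and $a\in\mathcal S'(\mathbb R^{2d})$, and let $\hat{\mathcal A}$ be any metaplectic operator with projection $\mathcal A$. Then $$\sigma=\hat{\mathcal A}_{1/2}\hat{\mathcal A}^{-1}\bigl(a*W_{\mathcal A}(\varphi_2,\varphi_1)\bigr)\in\mathcal S'(\mathbb R^{2d})$$ is the Weyl symbol of $A_{a,\mathcal A}^{\varphi_1,\varphi_2}$: it satisfies $A_{a,\mathcal A}^{\varphi_1,\varphi_2}=\operatorname{Op}_w(\sigma)$, and it is the only tempered distribution on $\mathbb R^{2d}$ with this property. -/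

import Mathlib

open MeasureTheory SchwartzMap FourierTransform Real
open scoped ContDiff ComplexConjugate

noncomputable section

namespace ALoc

set_option linter.unusedSectionVars false

/-! ### The partial Fourier transform of Schwartz functions -/

section PartialFourier

variable {X T F : Type} [NormedAddCommGroup X] [NormedSpace ℝ X]
  [NormedAddCommGroup T] [InnerProductSpace ℝ T] [FiniteDimensional ℝ T]
  [MeasurableSpace T] [BorelSpace T]
  [NormedAddCommGroup F] [NormedSpace ℂ F] [CompleteSpace F] [FiniteDimensional ℝ X]

/-- The partial Fourier transform with respect to the second variable. -/
def partialFourierFun (G : X × T → F) (z : X × T) : F :=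
  ∫ t, 𝐞 (-inner ℝ t z.2) • G (z.1, t)

/-- Decay in the integration variable, uniformly in the parameter. -/
lemma exists_decay (k n : ℕ) : ∃ p : Seminorm ℝ 𝓢(X × T, F), Continuous p ∧
    ∀ (G : 𝓢(X × T, F)) (x : X) (t : T), ‖x‖ ^ k * ‖iteratedFDeriv ℝ n G (x, t)‖ ≤
      (1 + ‖t‖) ^ (-((volume : Measure T).integrablePower : ℝ)) * p G := by
  set N := (volume : Measure T).integrablePower
  have hc : Continuous (((Finset.Iic (N + k, n)).sup (schwartzSeminormFamily ℝ (X × T) F) :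
      Seminorm ℝ 𝓢(X × T, F)) : 𝓢(X × T, F) → ℝ) :=
    Seminorm.continuous_finsetSup fun i _ =>
      (schwartz_withSeminorms ℝ (X × T) F).continuous_seminorm i
  refine ⟨(2 ^ (N + k) : NNReal) •
    (Finset.Iic (N + k, n)).sup (schwartzSeminormFamily ℝ (X × T) F), ?_, fun G x t => ?_⟩
  · exact hc.const_smul (2 ^ (N + k) : NNReal)
  · have h := one_add_le_sup_seminorm_apply (𝕜 := ℝ) (m := (N + k, n)) (k := N + k) (n := n)
      le_rfl le_rfl G (x, t)
    rw [Real.rpow_neg (by positivity), ← div_eq_inv_mul, le_div_iff₀' (by positivity),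
      Real.rpow_natCast]
    have h1 : ‖x‖ ≤ 1 + ‖(x, t)‖ := by
      have := norm_fst_le (x, t); simp only at this; linarith
    have h2 : ‖t‖ ≤ ‖(x, t)‖ := norm_snd_le (x, t)
    calc (1 + ‖t‖) ^ N * (‖x‖ ^ k * ‖iteratedFDeriv ℝ n G (x, t)‖)
        ≤ (1 + ‖(x, t)‖) ^ N * ((1 + ‖(x, t)‖) ^ k * ‖iteratedFDeriv ℝ n G (x, t)‖) := by
          gcongr
      _ = (1 + ‖(x, t)‖) ^ (N + k) * ‖iteratedFDeriv ℝ n G (x, t)‖ := by ring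
      _ ≤ _ := h

lemma slice_hasTemperateGrowth (x : X) : (fun t : T => (x, t)).HasTemperateGrowth := by
  have : (fun t : T => (x, t)) = fun t => (x, (0 : T)) + ContinuousLinearMap.inr ℝ X T t := by
    ext t <;> simp
  rw [this]
  fun_prop

/-- The restriction of a Schwartz function to an affine slice. -/
def slice (x : X) : 𝓢(X × T, F) →L[ℂ] 𝓢(T, F) :=
  compCLMOfAntilipschitz ℂ (K := 1) (slice_hasTemperateGrowth x)
    (AntilipschitzWith.of_le_mul_dist fun s t => by simp [Prod.dist_eq])

@[simp] lemma slice_apply (x : X) (G : 𝓢(X × T, F)) (t : T) : slice x G t = G (x, t) := rfl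

lemma norm_iteratedFDeriv_slice_le (x : X) (G : 𝓢(X × T, F)) (n : ℕ) (t : T) :
    ‖iteratedFDeriv ℝ n (slice x G) t‖ ≤ ‖iteratedFDeriv ℝ n G (x, t)‖ := by
  have h : (slice x G : T → F) =
      (fun w => G ((x, 0) + w)) ∘ ContinuousLinearMap.inr ℝ X T := by
    ext t; simp
  have hG : ContDiff ℝ ∞ (fun w => G ((x, 0) + w)) := (G.smooth ⊤).comp (by fun_prop)
  rw [h]
  rw [(ContinuousLinearMap.inr ℝ X T).iteratedFDeriv_comp_right hG _ (mod_cast le_top)]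
  refine (ContinuousMultilinearMap.norm_compContinuousLinearMap_le _ _).trans ?_
  rw [iteratedFDeriv_comp_add_left]
  have h1 : ‖ContinuousLinearMap.inr ℝ X T‖ ≤ 1 := ContinuousLinearMap.norm_inr_le_one ℝ X T
  simp only [ContinuousLinearMap.inr_apply, Prod.mk_add_mk, add_zero, zero_add,
    Finset.prod_const, Finset.card_univ, Fintype.card_fin]
  exact mul_le_of_le_one_right (norm_nonneg _) (pow_le_one₀ (norm_nonneg _) h1)

lemma partialFourierFun_eq (G : 𝓢(X × T, F)) (z : X × T) :
    partialFourierFun G z = 𝓕 (slice z.1 G) z.2 := by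
  simp [partialFourierFun, fourier_coe, Real.fourier_eq]

lemma partialFourier_bound_zero (k : ℕ) : ∃ p : Seminorm ℝ 𝓢(X × T, F), Continuous p ∧
    ∀ (G : 𝓢(X × T, F)) (z : X × T), ‖z‖ ^ k * ‖partialFourierFun G z‖ ≤ p G := by
  choose p hp hpG using fun q : ℕ × ℕ => exists_decay (X := X) (T := T) (F := F) q.1 q.2
  set I : ℝ := ∫ t : T, (1 + ‖t‖) ^ (-((volume : Measure T).integrablePower : ℝ)) with hI
  have hI0 : 0 ≤ I := integral_nonneg fun t => by positivity
  have hint := Measure.integrable_pow_neg_integrablePower (volume : Measure T)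
  have key : ∀ (i j : ℕ) (G : 𝓢(X × T, F)) (x : X),
      ‖x‖ ^ i * ∫ t, ‖iteratedFDeriv ℝ j (slice x G) t‖ ≤ I * p (i, j) G := by
    intro i j G x
    rw [← integral_const_mul, hI, ← integral_mul_const]
    refine integral_mono_of_nonneg (.of_forall fun t => by positivity)
      (hint.mul_const _) (.of_forall fun t => ?_)
    exact (mul_le_mul_of_nonneg_left (norm_iteratedFDeriv_slice_le x G j t)
      (by positivity)).trans (hpG (i, j) G x t)
  let q : Seminorm ℝ 𝓢(X × T, F) := ∑ j ∈ Finset.range (k + 1), p (0, j)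
  have hq : Continuous q := by
    have : (q : 𝓢(X × T, F) → ℝ) = fun G => ∑ j ∈ Finset.range (k + 1), p (0, j) G := by
      ext G; simp [q]
    rw [this]
    exact continuous_finsetSum _ fun j _ => hp (0, j)
  refine ⟨I.toNNReal • p (k, 0) + (2 ^ k * I.toNNReal) • q, ?_, fun G z => ?_⟩
  · exact ((hp (k, 0)).const_smul I.toNNReal).add (hq.const_smul (2 ^ k * I.toNNReal))
  obtain ⟨x, ξ⟩ := z
  have h1 : ‖x‖ ^ k * ‖partialFourierFun G (x, ξ)‖ ≤ I * p (k, 0) G := by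
    refine le_trans ?_ (key k 0 G x)
    gcongr
    refine (norm_integral_le_integral_norm _).trans (le_of_eq ?_)
    simp
  have h2 : ‖ξ‖ ^ k * ‖partialFourierFun G (x, ξ)‖ ≤ 2 ^ k * I * q G := by
    have := pow_mul_norm_iteratedFDeriv_fourier_le (K := ⊤) (N := ⊤) ((slice x G).smooth ⊤)
      (fun k n _ _ => integrable_pow_mul_iteratedFDeriv _ (slice x G) k n) (k := 0) (n := k)
      le_top le_top ξ
    simp only [norm_iteratedFDeriv_zero, pow_zero, one_mul, zero_add, CharP.cast_eq_zero,
      mul_zero, Finset.range_one, Finset.singleton_product, Finset.sum_map] at this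
    rw [partialFourierFun_eq]
    refine this.trans ?_
    rw [mul_assoc]
    gcongr
    have : I * q G = ∑ j ∈ Finset.range (k + 1), I * p (0, j) G := by
      simp [q, Finset.mul_sum]
    rw [this]
    refine Finset.sum_le_sum fun j _ => ?_
    simpa using key 0 j G x
  have h3 : ‖(x, ξ)‖ ^ k ≤ ‖x‖ ^ k + ‖ξ‖ ^ k := by
    rw [Prod.norm_def]
    rcases max_choice ‖x‖ ‖ξ‖ with h | h <;> simp only [h] <;>
      [skip; skip] <;> nlinarith [pow_nonneg (norm_nonneg x) k, pow_nonneg (norm_nonneg ξ) k]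
  calc ‖(x, ξ)‖ ^ k * ‖partialFourierFun G (x, ξ)‖
      ≤ (‖x‖ ^ k + ‖ξ‖ ^ k) * ‖partialFourierFun G (x, ξ)‖ := by gcongr
    _ ≤ I * p (k, 0) G + 2 ^ k * I * q G := by rw [add_mul]; exact add_le_add h1 h2
    _ = _ := by
      simp [NNReal.smul_def, hI0]

/-- The derivative in the direction `v` of the partial Fourier transform of `G` is the partial Fourier
transform of `partialD v G`. -/
def partialD (v : X × T) : 𝓢(X × T, F) →L[ℂ] 𝓢(X × T, F) :=
  LineDeriv.lineDerivOpCLM ℂ 𝓢(X × T, F) ((v.1, 0) : X × T) -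
  (2 * π * Complex.I : ℂ) • smulLeftCLM F (fun w : X × T => ((inner ℝ w.2 v.2 : ℝ) : ℂ))

lemma partialD_apply (v : X × T) (G : 𝓢(X × T, F)) (w : X × T) :
    partialD v G w =
      fderiv ℝ G w (v.1, 0) - (2 * π * Complex.I : ℂ) • ((inner ℝ w.2 v.2 : ℝ) : ℂ) • G w := by
  have h1 : (fun w : X × T => (inner ℝ w.2 v.2 : ℝ)).HasTemperateGrowth :=
    (Function.hasTemperateGrowth_inner_left v.2).comp (ContinuousLinearMap.snd ℝ X T).hasTemperateGrowth
  have h : (fun w : X × T => ((inner ℝ w.2 v.2 : ℝ) : ℂ)).HasTemperateGrowth := by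
    fun_prop
  simp [partialD, smulLeftCLM_apply_apply h, lineDerivOp_apply_eq_fderiv]

variable (X T) in
/-- Coordinates on the phase space. -/
def bas : Module.Basis (Fin (Module.finrank ℝ (X × T))) ℝ (X × T) := Module.finBasis ℝ (X × T)

variable (X T) in
/-- Coordinates on the phase space. -/
def crd (i : Fin (Module.finrank ℝ (X × T))) : X × T →L[ℝ] ℝ :=
  ((bas X T).coord i).toContinuousLinearMap

lemma sum_crd (M : X × T → F) (h1 : ∀ v w, M (v + w) = M v + M w)
    (h2 : ∀ (c : ℝ) v, M (c • v) = c • M v) (v : X × T) :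
    ∑ i, crd X T i v • M (bas X T i) = M v := by
  let L : X × T →ₗ[ℝ] F := ⟨⟨M, h1⟩, h2⟩
  have : L v = L (∑ i, (bas X T).repr v i • bas X T i) := by rw [(bas X T).sum_repr]
  change _ = L v
  rw [this, map_sum]
  simp only [map_smul]
  rfl

lemma hasFDerivAt_integrand (G : 𝓢(X × T, F)) (z : X × T) (t : T) :
    HasFDerivAt (fun z : X × T => 𝐞 (-inner ℝ t z.2) • G (z.1, t))
      (∑ i, (crd X T i).smulRight (𝐞 (-inner ℝ t z.2) • partialD (bas X T i) G (z.1, t))) z := by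
  have h1 : HasFDerivAt (fun z : X × T => G (z.1, t))
      ((fderiv ℝ G (z.1, t)).comp
        ((ContinuousLinearMap.inl ℝ X T).comp (ContinuousLinearMap.fst ℝ X T))) z := by
    have hG := (G.differentiableAt (x := (z.1, t))).hasFDerivAt
    refine HasFDerivAt.comp z hG ?_
    have := (ContinuousLinearMap.fst ℝ X T).hasFDerivAt (x := z)
    exact (this.prodMk (hasFDerivAt_const t z)).congr_fderiv (by ext <;> simp)
  obtain ⟨L, hL⟩ : ∃ L : T →L[ℝ] T →L[ℝ] ℝ, ∀ a b, L a b = inner ℝ a b :=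
    ⟨innerSL ℝ, fun _ _ => rfl⟩
  have h2 := (hasFDerivAt_fourierChar_neg_bilinear_right L t z.2).comp z
    (ContinuousLinearMap.snd ℝ X T).hasFDerivAt
  have h3 := h2.smul h1
  have e : (fun z : X × T => 𝐞 (-inner ℝ t z.2) • G (z.1, t)) =
      ((fun w => (𝐞 (-L t w) : ℂ)) ∘ (ContinuousLinearMap.snd ℝ X T)) •
        fun z : X × T => G (z.1, t) := by
    ext w; simp [hL, Circle.smul_def]
  rw [e]
  refine h3.congr_fderiv (ContinuousLinearMap.ext fun w => ?_)
  rw [sum_apply]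
  simp only [ContinuousLinearMap.smulRight_apply]
  rw [sum_crd (fun v => 𝐞 (-inner ℝ t z.2) • partialD v G (z.1, t))]
  · simp only [hL, add_apply, smul_apply,
      ContinuousLinearMap.comp_apply, ContinuousLinearMap.smulRight_apply, Circle.smul_def,
      partialD_apply, ContinuousLinearMap.inl_apply, ContinuousLinearMap.coe_fst',
      ContinuousLinearMap.coe_snd', Function.comp_apply, smul_sub, Complex.ofRealCLM_apply]
    rw [sub_eq_add_neg]
    congr 1
    rw [smul_smul, smul_smul, ← neg_smul]
    congr 1
    simp only [smul_eq_mul]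
    ring
  · intro v w
    simp only [partialD_apply, Prod.fst_add, Prod.snd_add, inner_add_right, ← smul_add]
    have : ((v.1 + w.1, 0) : X × T) = (v.1, 0) + (w.1, 0) := by simp
    rw [this, map_add]
    push_cast
    rw [add_smul, smul_add]
    congr 1
    abel
  · intro c v
    simp only [partialD_apply, Prod.smul_fst, Prod.smul_snd, inner_smul_right]
    have : ((c • v.1, 0) : X × T) = c • (v.1, 0) := by simp
    rw [this, map_smul, smul_comm c (𝐞 _), smul_sub c]
    congr 2
    rw [Complex.ofReal_mul, mul_smul (c : ℂ), Complex.coe_smul c,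
      smul_comm (2 * π * Complex.I : ℂ) c]

lemma hasFDerivAt_partialFourierFun (G : 𝓢(X × T, F)) (z : X × T) :
    HasFDerivAt (partialFourierFun G)
      (∑ i, (crd X T i).smulRight (partialFourierFun (partialD (bas X T i) G) z)) z := by
  choose p _ hp using fun i => exists_decay (X := X) (T := T) (F := F) 0 0
  have hint : ∀ i, Integrable fun t => 𝐞 (-inner ℝ t z.2) • partialD (bas X T i) G (z.1, t) :=
    fun i => (Real.fourierIntegral_convergent_iff z.2).2
      (slice z.1 (partialD (bas X T i) G)).integrable
  have key : (∑ i, (crd X T i).smulRight (partialFourierFun (partialD (bas X T i) G) z)) =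
      ∫ t, ∑ i, (crd X T i).smulRight
        (𝐞 (-inner ℝ t z.2) • partialD (bas X T i) G (z.1, t)) := by
    refine Eq.trans ?_ (integral_finsetSum _ fun i _ =>
      ((ContinuousLinearMap.smulRightL ℝ (X × T) F) (crd X T i)).integrable_comp (hint i)).symm
    exact Finset.sum_congr rfl fun i _ =>
      (((ContinuousLinearMap.smulRightL ℝ (X × T) F) (crd X T i)).integral_comp_comm
        (hint i)).symm
  rw [key]
  refine hasFDerivAt_integral_of_dominated_of_fderiv_le
    (F := fun (z : X × T) (t : T) => 𝐞 (-inner ℝ t z.2) • G (z.1, t))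
    (F' := fun (z : X × T) (t : T) => ∑ i, (crd X T i).smulRight
        (𝐞 (-inner ℝ t z.2) • partialD (bas X T i) G (z.1, t)))
    (bound := fun t => (1 + ‖t‖) ^ (-((volume : Measure T).integrablePower : ℝ)) *
      ∑ i, ‖crd X T i‖ * p i (partialD (bas X T i) G)) Filter.univ_mem
      (.of_forall fun w => ?_) ?_ ?_ ?_ ?_ ?_
  · exact (Continuous.smul (by fun_prop)
      (slice w.1 G).continuous).aestronglyMeasurable
  · exact (Real.fourierIntegral_convergent_iff z.2).2 (slice z.1 G).integrable
  · refine Continuous.aestronglyMeasurable (continuous_finsetSum _ fun i _ => ?_)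
    refine ((ContinuousLinearMap.smulRightL ℝ (X × T) F) (crd X T i)).continuous.comp ?_
    exact Continuous.smul (by fun_prop)
      (slice z.1 (partialD (bas X T i) G)).continuous
  · refine .of_forall fun t w _ => (norm_sum_le _ _).trans ?_
    rw [Finset.mul_sum]
    refine Finset.sum_le_sum fun i _ => ?_
    rw [ContinuousLinearMap.norm_smulRight_apply, mul_left_comm, Circle.norm_smul]
    gcongr
    simpa using hp i (partialD (bas X T i) G) w.1 t
  · exact (Measure.integrable_pow_neg_integrablePower _).mul_const _
  · exact .of_forall fun t w _ => hasFDerivAt_integrand G w t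

lemma contDiff_partialFourierFun (n : ℕ) : ∀ (G : 𝓢(X × T, F)),
    ContDiff ℝ n (partialFourierFun G) := by
  induction n with
  | zero =>
    intro G
    exact contDiff_zero.2 (continuous_iff_continuousAt.2 fun z =>
      (hasFDerivAt_partialFourierFun G z).continuousAt)
  | succ n ih =>
    intro G
    rw [Nat.cast_succ, contDiff_succ_iff_hasFDerivAt]
    refine ⟨_, ?_, hasFDerivAt_partialFourierFun G⟩
    refine ContDiff.sum fun i _ => ?_
    exact ((ContinuousLinearMap.smulRightL ℝ (X × T) F) (crd X T i)).contDiff.comp (ih _)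

lemma partialFourier_bound (k n : ℕ) : ∃ p : Seminorm ℝ 𝓢(X × T, F), Continuous p ∧
    ∀ (G : 𝓢(X × T, F)) (z : X × T),
      ‖z‖ ^ k * ‖iteratedFDeriv ℝ n (partialFourierFun G) z‖ ≤ p G := by
  induction n with
  | zero => simpa using partialFourier_bound_zero (X := X) (T := T) (F := F) k
  | succ n ih =>
    obtain ⟨p, hp, h⟩ := ih
    let q : Seminorm ℝ 𝓢(X × T, F) := ∑ i, (‖crd X T i‖₊) •
      p.comp ((partialD (bas X T i)).restrictScalars ℝ).toLinearMap
    have hq : ∀ G, q G = ∑ i, ‖crd X T i‖ * p (partialD (bas X T i) G) := by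
      intro G; simp [q, NNReal.smul_def]
    refine ⟨q, ?_, fun G z => ?_⟩
    · rw [show (q : 𝓢(X × T, F) → ℝ) = _ from funext hq]
      exact continuous_finsetSum _ fun i _ =>
        continuous_const.mul (hp.comp (partialD (bas X T i)).continuous)
    have : fderiv ℝ (partialFourierFun G) = fun z => ∑ i,
        (ContinuousLinearMap.smulRightL ℝ (X × T) F) (crd X T i)
          (partialFourierFun (partialD (bas X T i) G) z) :=
      funext fun z => (hasFDerivAt_partialFourierFun G z).fderiv
    have hcd : ∀ i, ContDiff ℝ n (fun z => (ContinuousLinearMap.smulRightL ℝ (X × T) F)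
        (crd X T i) (partialFourierFun (partialD (bas X T i) G) z)) := fun i =>
      ((ContinuousLinearMap.smulRightL ℝ (X × T) F) (crd X T i)).contDiff.comp
        (contDiff_partialFourierFun n _)
    rw [← norm_iteratedFDeriv_fderiv, this, iteratedFDeriv_fun_sum_apply fun i _ => (hcd i).contDiffAt]
    rw [hq]
    calc _ ≤ ‖z‖ ^ k * ∑ i, ‖crd X T i‖ *
          ‖iteratedFDeriv ℝ n (partialFourierFun (partialD (bas X T i) G)) z‖ := by
          gcongr
          refine (norm_sum_le _ _).trans (Finset.sum_le_sum fun i _ => ?_)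
          refine (ContinuousLinearMap.norm_iteratedFDeriv_comp_left _
            (contDiff_partialFourierFun n (partialD (bas X T i) G)).contDiffAt le_rfl).trans ?_
          gcongr
          exact ContinuousLinearMap.opNorm_le_bound _ (norm_nonneg (crd X T i)) fun y => by simp
      _ = ∑ i, ‖crd X T i‖ * (‖z‖ ^ k *
          ‖iteratedFDeriv ℝ n (partialFourierFun (partialD (bas X T i) G)) z‖) := by
          rw [Finset.mul_sum]; exact Finset.sum_congr rfl fun i _ => by ring
      _ ≤ _ := by
          gcongr with i
          exact h _ z

variable (X T F) in
/-- The partial Fourier transform with respect to the second variable, on Schwartz functions. -/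
def partialFourier : 𝓢(X × T, F) →L[ℂ] 𝓢(X × T, F) :=
  mkCLM (fun G => partialFourierFun G)
    (fun f g z => by
      rw [partialFourierFun_eq, partialFourierFun_eq, partialFourierFun_eq, map_add,
        FourierTransform.fourier_add]; rfl)
    (fun c f z => by
      rw [partialFourierFun_eq, partialFourierFun_eq, map_smul,
        FourierTransform.fourier_smul]; rfl)
    (fun G => contDiff_infty.2 fun n => contDiff_partialFourierFun n G)
    (fun ⟨k, n⟩ => by
      obtain ⟨p, hp, h⟩ := partialFourier_bound (X := X) (T := T) k n (F := F)
      obtain ⟨s, C, -, hC⟩ := Seminorm.bound_of_continuous (schwartz_withSeminorms ℝ (X × T) F) p hp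
      refine ⟨s, C, C.2, fun G z => (h G z).trans ((hC G).trans (le_of_eq ?_))⟩
      rw [smul_apply, NNReal.smul_def, smul_eq_mul]
      congr 1
      simp only [Seminorm.finset_sup_apply]
      rfl)

lemma partialFourier_apply (G : 𝓢(X × T, F)) (z : X × T) :
    partialFourier X T F G z = ∫ t, 𝐞 (-inner ℝ t z.2) • G (z.1, t) := rfl

end PartialFourier

section Coordinates

/-! ### Euclidean spaces and phase-space coordinates -/

/-- The space `ℝ^ι`. -/
abbrev E (ι : Type) : Type := EuclideanSpace ℝ ι

/-- `L²(ℝ^ι)`. -/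
abbrev L2 (ι : Type) [Fintype ι] : Type := Lp ℂ 2 (volume : Measure (E ι))

variable {ι κ : Type} [Fintype ι] [Fintype κ]

/-- The identification `ℝ^{ι ⊕ κ} = ℝ^ι × ℝ^κ`. -/
def splitCLE (ι κ : Type) [Fintype ι] [Fintype κ] : E (ι ⊕ κ) ≃L[ℝ] E ι × E κ :=
  LinearEquiv.toContinuousLinearEquiv
  { toFun := fun z => (WithLp.toLp 2 fun i => z (Sum.inl i), WithLp.toLp 2 fun j => z (Sum.inr j))
    invFun := fun p => WithLp.toLp 2 (Sum.elim p.1 p.2)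
    left_inv := fun z => by ext (i | i) <;> simp
    right_inv := fun p => by ext i <;> simp
    map_add' := fun z w => by ext i <;> simp
    map_smul' := fun c z => by ext i <;> simp }

/-- The point `(x, y)` of `ℝ^{ι ⊕ κ}`. -/
def pt (x : E ι) (y : E κ) : E (ι ⊕ κ) := WithLp.toLp 2 (Sum.elim x y)

/-- The first component of a point of `ℝ^{ι ⊕ κ}`. -/
def fstPart (z : E (ι ⊕ κ)) : E ι := WithLp.toLp 2 fun i => z (Sum.inl i)

/-- The second component of a point of `ℝ^{ι ⊕ κ}`. -/
def sndPart (z : E (ι ⊕ κ)) : E κ := WithLp.toLp 2 fun j => z (Sum.inr j)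

lemma splitCLE_apply (z : E (ι ⊕ κ)) : splitCLE ι κ z = (fstPart z, sndPart z) := rfl

lemma splitCLE_symm_apply (p : E ι × E κ) : (splitCLE ι κ).symm p = pt p.1 p.2 := rfl

@[simp] lemma fstPart_pt (x : E ι) (y : E κ) : fstPart (pt x y) = x := by ext; simp [fstPart, pt]

@[simp] lemma sndPart_pt (x : E ι) (y : E κ) : sndPart (pt x y) = y := by ext; simp [sndPart, pt]

lemma pt_parts (z : E (ι ⊕ κ)) : pt (fstPart z) (sndPart z) = z :=
  (splitCLE ι κ).symm_apply_apply z

/-! ### Conjugates, tensor products and convolutions -/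

section Conj

variable {V : Type} [NormedAddCommGroup V] [NormedSpace ℝ V]

/-- Complex conjugation of Schwartz functions. -/
def conjS : 𝓢(V, ℂ) →L⋆[ℂ] 𝓢(V, ℂ) :=
  mkCLM (fun f x => conj (f x)) (fun _ _ _ => by simp) (fun _ _ _ => by simp)
    (fun f => Complex.conjCLE.contDiff.comp (f.smooth ⊤))
    (fun ⟨k, n⟩ => ⟨{(k, n)}, 1, zero_le_one, fun f x => by
      have h : (fun x => conj (f x)) = Complex.conjLIE ∘ f := by ext; simp
      rw [h, LinearIsometryEquiv.norm_iteratedFDeriv_comp_left]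
      simpa using f.le_seminorm ℂ k n x⟩)

@[simp] lemma conjS_apply (f : 𝓢(V, ℂ)) (x : V) : conjS f x = conj (f x) := rfl

@[simp] lemma conjS_conjS (f : 𝓢(V, ℂ)) : conjS (conjS f) = f := by ext; simp

end Conj

section Tensor

variable {X Y : Type} [NormedAddCommGroup X] [NormedSpace ℝ X]
  [NormedAddCommGroup Y] [NormedSpace ℝ Y]

lemma tensor_contDiff (f : 𝓢(X, ℂ)) (g : 𝓢(Y, ℂ)) :
    ContDiff ℝ ∞ (fun z : X × Y => f z.1 * g z.2) :=
  ((f.smooth ⊤).comp contDiff_fst).mul ((g.smooth ⊤).comp contDiff_snd)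

lemma tensor_bound (k n : ℕ) (f : 𝓢(X, ℂ)) (g : 𝓢(Y, ℂ)) (z : X × Y) :
    ‖z‖ ^ k * ‖iteratedFDeriv ℝ n (fun z : X × Y => f z.1 * g z.2) z‖ ≤
      2 ^ n * 2 ^ k * 2 ^ k *
      ((Finset.Iic (k, n)).sup (fun m => SchwartzMap.seminorm ℂ m.1 m.2) f) *
      ((Finset.Iic (k, n)).sup (fun m => SchwartzMap.seminorm ℂ m.1 m.2) g) := by
  set a := (Finset.Iic (k, n)).sup (fun m => SchwartzMap.seminorm ℂ m.1 m.2) f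
  set b := (Finset.Iic (k, n)).sup (fun m => SchwartzMap.seminorm ℂ m.1 m.2) g
  have hf : ContDiff ℝ n (fun z : X × Y => f z.1) := (f.smooth n).comp contDiff_fst
  have hg : ContDiff ℝ n (fun z : X × Y => g z.2) := (g.smooth n).comp contDiff_snd
  have h1 : ∀ i ≤ n, ‖iteratedFDeriv ℝ i (fun z : X × Y => f z.1) z‖ ≤
      ‖iteratedFDeriv ℝ i f z.1‖ := by
    intro i hi
    have : (fun z : X × Y => f z.1) = f ∘ ContinuousLinearMap.fst ℝ X Y := rfl
    rw [this, (ContinuousLinearMap.fst ℝ X Y).iteratedFDeriv_comp_right (f.smooth i) _ le_rfl]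
    refine (ContinuousMultilinearMap.norm_compContinuousLinearMap_le _ _).trans ?_
    simp only [Finset.prod_const, Finset.card_univ, Fintype.card_fin]
    exact mul_le_of_le_one_right (norm_nonneg _)
      (pow_le_one₀ (norm_nonneg _) (ContinuousLinearMap.norm_fst_le ℝ X Y))
  have h2 : ∀ i ≤ n, ‖iteratedFDeriv ℝ i (fun z : X × Y => g z.2) z‖ ≤
      ‖iteratedFDeriv ℝ i g z.2‖ := by
    intro i hi
    have : (fun z : X × Y => g z.2) = g ∘ ContinuousLinearMap.snd ℝ X Y := rfl
    rw [this, (ContinuousLinearMap.snd ℝ X Y).iteratedFDeriv_comp_right (g.smooth i) _ le_rfl]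
    refine (ContinuousMultilinearMap.norm_compContinuousLinearMap_le _ _).trans ?_
    simp only [Finset.prod_const, Finset.card_univ, Fintype.card_fin]
    exact mul_le_of_le_one_right (norm_nonneg _)
      (pow_le_one₀ (norm_nonneg _) (ContinuousLinearMap.norm_snd_le ℝ X Y))
  have hz : ‖z‖ ^ k ≤ (1 + ‖z.1‖) ^ k * (1 + ‖z.2‖) ^ k := by
    rw [← mul_pow]
    refine pow_le_pow_left₀ (norm_nonneg _) ?_ k
    rw [Prod.norm_def]
    refine max_le ?_ ?_ <;> nlinarith [norm_nonneg z.1, norm_nonneg z.2,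
      mul_nonneg (norm_nonneg z.1) (norm_nonneg z.2)]
  calc ‖z‖ ^ k * ‖iteratedFDeriv ℝ n (fun z : X × Y => f z.1 * g z.2) z‖
      ≤ ((1 + ‖z.1‖) ^ k * (1 + ‖z.2‖) ^ k) * ∑ i ∈ Finset.range (n + 1), (n.choose i : ℝ) *
        ‖iteratedFDeriv ℝ i (fun z : X × Y => f z.1) z‖ *
          ‖iteratedFDeriv ℝ (n - i) (fun z : X × Y => g z.2) z‖ := by
        gcongr
        exact norm_iteratedFDeriv_mul_le hf hg z (mod_cast le_rfl)
    _ = ∑ i ∈ Finset.range (n + 1), (n.choose i : ℝ) *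
        ((1 + ‖z.1‖) ^ k * ‖iteratedFDeriv ℝ i (fun z : X × Y => f z.1) z‖) *
          ((1 + ‖z.2‖) ^ k * ‖iteratedFDeriv ℝ (n - i) (fun z : X × Y => g z.2) z‖) := by
        rw [Finset.mul_sum]; exact Finset.sum_congr rfl fun i _ => by ring
    _ ≤ ∑ i ∈ Finset.range (n + 1), (n.choose i : ℝ) * (2 ^ k * a) * (2 ^ k * b) := by
        refine Finset.sum_le_sum fun i hi => ?_
        have hi' : i ≤ n := Nat.lt_succ_iff.1 (Finset.mem_range.1 hi)
        have e1 : (1 + ‖z.1‖) ^ k * ‖iteratedFDeriv ℝ i (fun z : X × Y => f z.1) z‖ ≤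
            2 ^ k * a := (mul_le_mul_of_nonneg_left (h1 i hi') (by positivity)).trans
              (one_add_le_sup_seminorm_apply (𝕜 := ℂ) (m := (k, n)) le_rfl hi' f z.1)
        have e2 : (1 + ‖z.2‖) ^ k * ‖iteratedFDeriv ℝ (n - i) (fun z : X × Y => g z.2) z‖ ≤
            2 ^ k * b := (mul_le_mul_of_nonneg_left (h2 (n - i) (Nat.sub_le _ _))
              (by positivity)).trans
              (one_add_le_sup_seminorm_apply (𝕜 := ℂ) (m := (k, n)) le_rfl (Nat.sub_le _ _) g z.2)
        exact mul_le_mul (mul_le_mul_of_nonneg_left e1 (by positivity)) e2 (by positivity)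
          (mul_nonneg (by positivity) (le_trans (by positivity) e1))
    _ = _ := by
        simp_rw [mul_assoc]
        rw [← Finset.sum_mul, ← Nat.cast_sum, Nat.sum_range_choose]
        push_cast
        ring

/-- `g ↦ f ⊗ g` on a product space. -/
def tensorRightProd (f : 𝓢(X, ℂ)) : 𝓢(Y, ℂ) →L[ℂ] 𝓢(X × Y, ℂ) :=
  mkCLM (fun g z => f z.1 * g z.2) (fun _ _ _ => by simp [mul_add])
    (fun _ _ _ => by simp [mul_left_comm]) (fun g => tensor_contDiff f g)
    (fun ⟨k, n⟩ => ⟨Finset.Iic (k, n), _, by positivity, fun g z => tensor_bound k n f g z⟩)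

/-- `f ↦ f ⊗ g` on a product space. -/
def tensorLeftProd (g : 𝓢(Y, ℂ)) : 𝓢(X, ℂ) →L[ℂ] 𝓢(X × Y, ℂ) :=
  mkCLM (fun f z => f z.1 * g z.2) (fun _ _ _ => by simp [add_mul])
    (fun _ _ _ => by simp [mul_assoc]) (fun f => tensor_contDiff f g)
    (fun ⟨k, n⟩ => ⟨Finset.Iic (k, n), _, by positivity, fun f z =>
      (tensor_bound k n f g z).trans (le_of_eq (mul_right_comm _ _ _))⟩)

end Tensor

/-- The tensor product `f ⊗ g (x, y) = f x * g y`, as a map of its second factor. -/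
def tensorRight (f : 𝓢(E ι, ℂ)) : 𝓢(E κ, ℂ) →L[ℂ] 𝓢(E (ι ⊕ κ), ℂ) :=
  (compCLMOfContinuousLinearEquiv ℂ (splitCLE ι κ)).comp (tensorRightProd f)

/-- The tensor product `f ⊗ g (x, y) = f x * g y`, as a map of its first factor. -/
def tensorLeft (g : 𝓢(E κ, ℂ)) : 𝓢(E ι, ℂ) →L[ℂ] 𝓢(E (ι ⊕ κ), ℂ) :=
  (compCLMOfContinuousLinearEquiv ℂ (splitCLE ι κ)).comp (tensorLeftProd g)

/-- The tensor product `f ⊗ g (x, y) = f x * g y`. -/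
def tensor (f : 𝓢(E ι, ℂ)) (g : 𝓢(E κ, ℂ)) : 𝓢(E (ι ⊕ κ), ℂ) := tensorRight f g

lemma tensor_apply (f : 𝓢(E ι, ℂ)) (g : 𝓢(E κ, ℂ)) (z : E (ι ⊕ κ)) :
    tensor f g z = f (fstPart z) * g (sndPart z) := rfl

/-! ### The Schrödinger representation -/

lemma schrodinger_memLp (z : E (ι ⊕ ι)) (τ : ℝ) (u : L2 ι) :
    MemLp (fun t : E ι => Complex.exp (2 * π * Complex.I * τ) *
      Complex.exp (-(π * Complex.I * inner ℝ (fstPart z) (sndPart z))) *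
      (Complex.exp (2 * π * Complex.I * inner ℝ (sndPart z) t) * u (t - fstPart z))) 2 := by
  have h1 : MemLp (fun t : E ι => u (t - fstPart z)) 2 :=
    (Lp.memLp u).comp_measurePreserving (measurePreserving_sub_right volume (fstPart z))
  refine h1.of_le ((Continuous.aestronglyMeasurable (by fun_prop)).mul
    ((Continuous.aestronglyMeasurable (by fun_prop)).mul h1.1)) (.of_forall fun t => ?_)
  have e : ∀ r : ℝ, ‖Complex.exp (r * Complex.I)‖ = 1 := Complex.norm_exp_ofReal_mul_I
  have e1 := e (2 * π * τ)
  have e2 := e (-(π * inner ℝ (fstPart z) (sndPart z)))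
  have e3 := e (2 * π * inner ℝ (sndPart z) t)
  push_cast at e1 e2 e3
  rw [norm_mul, norm_mul, norm_mul,
    show (2 * π * Complex.I * τ : ℂ) = 2 * π * τ * Complex.I by ring,
    show (-(π * Complex.I * (inner ℝ (fstPart z) (sndPart z) : ℝ)) : ℂ) =
      -(π * (inner ℝ (fstPart z) (sndPart z) : ℝ)) * Complex.I by ring,
    show (2 * π * Complex.I * (inner ℝ (sndPart z) t : ℝ) : ℂ) =
      2 * π * (inner ℝ (sndPart z) t : ℝ) * Complex.I by ring, e1, e2, e3]
  simp

/-- The Schrödinger representation of the Heisenberg group on `L²(ℝ^ι)`: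
`ρ(x, ξ; τ) u (t) = e^{2πiτ} e^{-πi x·ξ} e^{2πi ξ·t} u(t - x)`. -/
def schrodinger (z : E (ι ⊕ ι)) (τ : ℝ) (u : L2 ι) : L2 ι :=
  (schrodinger_memLp z τ u).toLp

end Coordinates

section Schroedinger

variable {ι κ : Type} [Fintype ι] [Fintype κ]

lemma schrodinger_coeFn (z : E (ι ⊕ ι)) (τ : ℝ) (u : L2 ι) :
    schrodinger z τ u =ᵐ[volume] fun t : E ι => Complex.exp (2 * π * Complex.I * τ) *
      Complex.exp (-(π * Complex.I * inner ℝ (fstPart z) (sndPart z))) *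
      (Complex.exp (2 * π * Complex.I * inner ℝ (sndPart z) t) * u (t - fstPart z)) :=
  (schrodinger_memLp z τ u).coeFn_toLp

/-- A Schwartz function as an element of `L²`. -/
def toL2 : 𝓢(E ι, ℂ) →L[ℂ] L2 ι := toLpCLM ℂ ℂ 2 volume

lemma toL2_coeFn (f : 𝓢(E ι, ℂ)) : toL2 f =ᵐ[volume] f := f.coeFn_toLp 2 volume

lemma toL2_injective : Function.Injective (toL2 (ι := ι)) := injective_toLp 2 volume

lemma denseRange_toL2 : DenseRange (toL2 (ι := ι)) :=
  denseRange_toLpCLM (F := ℂ) (p := 2) (μ := (volume : Measure (E ι))) (by simp)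

lemma inner_toL2 (f g : 𝓢(E ι, ℂ)) : inner ℂ (toL2 f) (toL2 g) = ∫ x, conj (f x) * g x := by
  refine (inner_toL2_toL2_eq f g volume).trans (integral_congr_ae (.of_forall fun x => ?_))
  simp [mul_comm]

variable [DecidableEq ι]

/-- The linear action of a matrix on `ℝ^ι`. -/
def matVec (A : Matrix ι ι ℝ) (z : E ι) : E ι := WithLp.toLp 2 (A.mulVec z.ofLp)

/-- A metaplectic operator with projection `A`: a unitary operator `Â` of `L²(ℝ^ι)` such that
`Â ρ(z; τ) Â⁻¹ = ρ(A z; τ)` for every point `z` of the phase space and every real `τ`. For a given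
symplectic matrix `A` such an operator is unique up to a factor of modulus one. -/
structure MetaplecticOperator (A : Matrix.symplecticGroup ι ℝ) where
  /-- The unitary operator. -/
  toIso : L2 ι ≃ₗᵢ[ℂ] L2 ι
  /-- The intertwining relation. -/
  intertwines : ∀ (z : E (ι ⊕ ι)) (τ : ℝ) (u : L2 ι),
    toIso (schrodinger z τ (toIso.symm u)) = schrodinger (matVec A.1 z) τ u

/-- The action of a symplectic matrix as a linear equivalence. -/
def sympCLE (A : Matrix.symplecticGroup ι ℝ) : E (ι ⊕ ι) ≃L[ℝ] E (ι ⊕ ι) :=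
  LinearEquiv.toContinuousLinearEquiv
  { toFun := matVec A.1
    invFun := matVec (A⁻¹).1
    left_inv := fun z => by
      have h : (A⁻¹).1 * A.1 = 1 := congrArg Subtype.val (inv_mul_cancel A)
      simp [matVec, h]
    right_inv := fun z => by
      have h : A.1 * (A⁻¹).1 = 1 := congrArg Subtype.val (mul_inv_cancel A)
      simp [matVec, h]
    map_add' := fun z w => by simp [matVec, Matrix.mulVec_add]
    map_smul' := fun c z => by simp [matVec, Matrix.mulVec_smul] }

@[simp] lemma sympCLE_apply (A : Matrix.symplecticGroup ι ℝ) (z : E (ι ⊕ ι)) :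
    sympCLE A z = matVec A.1 z := rfl

namespace MetaplecticOperator

variable {A : Matrix.symplecticGroup ι ℝ}

/-- The inverse of a metaplectic operator. -/
def inv (U : MetaplecticOperator A) : MetaplecticOperator A⁻¹ where
  toIso := U.toIso.symm
  intertwines z τ u := by
    have h := U.intertwines (matVec (A⁻¹).1 z) τ (U.toIso u)
    have e : matVec A.1 (matVec (A⁻¹).1 z) = z := (sympCLE A).apply_symm_apply z
    rw [e, LinearIsometryEquiv.symm_apply_apply] at h
    rw [LinearIsometryEquiv.symm_symm, ← h, LinearIsometryEquiv.symm_apply_apply]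

end MetaplecticOperator

/-! ### Metaplectic operators preserve the Schwartz space -/

section Shear

variable {V : Type} [NormedAddCommGroup V] [NormedSpace ℝ V]

/-- `(x, t) ↦ (t + x / 2, t - x / 2)`. -/
def shear (V : Type) [NormedAddCommGroup V] [NormedSpace ℝ V] : (V × V) ≃L[ℝ] (V × V) where
  toFun p := (p.2 + (2⁻¹ : ℝ) • p.1, p.2 - (2⁻¹ : ℝ) • p.1)
  invFun q := (q.1 - q.2, (2⁻¹ : ℝ) • (q.1 + q.2))
  left_inv p := by
    ext
    · simp only [add_sub_sub_cancel]
      rw [← add_smul]; norm_num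
    · simp only [add_add_sub_cancel]
      rw [← two_smul ℝ, smul_smul]; norm_num
  right_inv q := by
    ext
    · simp only
      rw [← smul_add, add_add_sub_cancel, ← two_smul ℝ, smul_smul]; norm_num
    · simp only
      rw [← smul_sub, add_sub_sub_cancel, ← two_smul ℝ, smul_smul]; norm_num
  map_add' p q := by
    ext <;> simp only [Prod.fst_add, Prod.snd_add, smul_add] <;> abel
  map_smul' c p := by
    ext <;> simp only [Prod.smul_fst, Prod.smul_snd, RingHom.id_apply, smul_add, smul_sub,
      smul_comm c]
  continuous_toFun := by fun_prop
  continuous_invFun := by fun_prop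

lemma shear_apply (p : V × V) :
    shear V p = (p.2 + (2⁻¹ : ℝ) • p.1, p.2 - (2⁻¹ : ℝ) • p.1) := rfl

lemma shear_symm_apply (p : V × V) :
    (shear V).symm p = (p.1 - p.2, (2⁻¹ : ℝ) • (p.1 + p.2)) := rfl

end Shear

section FourierInj

variable {V : Type} [NormedAddCommGroup V] [InnerProductSpace ℝ V] [FiniteDimensional ℝ V]
  [MeasurableSpace V] [BorelSpace V]

lemma ae_eq_of_fourier_eq {h : V → ℂ} (hh : Integrable h) (r : 𝓢(V, ℂ))
    (e : ∀ ξ, 𝓕 h ξ = 𝓕 (r : V → ℂ) ξ) : h =ᵐ[volume] r := by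
  have hk : Integrable (fun x => h x - r x) := hh.sub r.integrable
  have hF : 𝓕 (fun x => h x - r x) = 0 := by
    ext ξ
    have h1 := (Real.fourierIntegral_convergent_iff ξ).2 hh
    have h2 := (Real.fourierIntegral_convergent_iff ξ).2 (r.integrable (μ := volume))
    have e' := e ξ
    rw [Real.fourier_eq, Real.fourier_eq] at e'
    rw [Real.fourier_eq]
    simp_rw [smul_sub]
    rw [integral_sub h1 h2, e', sub_self]
    rfl
  have key : ∀ᵐ x, (fun x => h x - r x) x = 0 := by
    refine ae_eq_zero_of_integral_contDiff_smul_eq_zero hk.locallyIntegrable fun g hg hc => ?_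
    have hg₁ : HasCompactSupport (Complex.ofRealCLM ∘ g) := hc.comp_left rfl
    have hg₂ : ContDiff ℝ ∞ (Complex.ofRealCLM ∘ g) := by fun_prop
    set χ : 𝓢(V, ℂ) := hg₁.toSchwartzMap hg₂
    set ψ : 𝓢(V, ℂ) := 𝓕⁻ χ
    have hχ : 𝓕 ψ = χ := FourierTransform.fourier_fourierInv_eq χ
    have := VectorFourier.integral_fourierIntegral_smul_eq_flip (L := innerₗ V) (μ := volume)
      (ν := volume) Real.continuous_fourierChar continuous_inner ψ.integrable hk
    have h3 : ∀ x, VectorFourier.fourierIntegral 𝐞 volume (innerₗ V) ψ x = (g x : ℂ) := by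
      intro x
      change 𝓕 (ψ : V → ℂ) x = _
      rw [← fourier_coe, hχ]
      rfl
    have h4 : ∀ x, VectorFourier.fourierIntegral 𝐞 volume (innerₗ V).flip
        (fun x => h x - r x) x = 0 := by
      intro x
      rw [flip_innerₗ]
      exact congrFun hF x
    simp only [h3, h4, smul_zero, integral_zero] at this
    simpa [Complex.real_smul] using this
  filter_upwards [key] with x hx using sub_eq_zero.1 hx

end FourierInj

lemma inner_schrodinger (u v : L2 ι) (x ξ : E ι) :
    inner ℂ (schrodinger (pt x ξ) 0 v) u =
      𝓕 (fun t => u (t + (2⁻¹ : ℝ) • x) * conj (v (t - (2⁻¹ : ℝ) • x))) ξ := by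
  rw [L2.inner_def, Real.fourier_eq,
    ← integral_add_right_eq_self (μ := volume) _ ((2⁻¹ : ℝ) • x)]
  have h := (measurePreserving_add_right (volume : Measure (E ι))
    ((2⁻¹ : ℝ) • x)).quasiMeasurePreserving.ae_eq_comp (schrodinger_coeFn (pt x ξ) 0 v)
  refine integral_congr_ae ?_
  filter_upwards [h] with t ht
  simp only [Function.comp_apply] at ht
  rw [ht]
  have e1 : t + (2⁻¹ : ℝ) • x - x = t - (2⁻¹ : ℝ) • x := by
    have : x = (2⁻¹ : ℝ) • x + (2⁻¹ : ℝ) • x := by rw [← add_smul]; norm_num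
    nth_rewrite 2 [this]
    abel
  simp only [RCLike.inner_apply, fstPart_pt, sndPart_pt, e1, map_mul, Circle.smul_def,
    Real.fourierChar_apply, smul_eq_mul]
  have e2 : conj (Complex.exp (2 * π * Complex.I * (0 : ℝ))) *
      conj (Complex.exp (-(π * Complex.I * (inner ℝ x ξ : ℝ)))) *
      conj (Complex.exp (2 * π * Complex.I * (inner ℝ ξ (t + (2⁻¹ : ℝ) • x) : ℝ))) =
      Complex.exp ((2 * π * -inner ℝ t ξ : ℝ) * Complex.I) := by
    rw [← Complex.exp_conj, ← Complex.exp_conj, ← Complex.exp_conj, ← Complex.exp_add,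
      ← Complex.exp_add, inner_add_right, inner_smul_right, real_inner_comm t ξ,
      real_inner_comm x ξ]
    congr 1
    simp only [map_mul, map_neg, Complex.conj_I, Complex.conj_ofReal, map_ofNat]
    push_cast
    ring
  rw [← e2]
  ring


/-- Reflection of the second variable. -/
def reflSnd (V : Type) [NormedAddCommGroup V] [NormedSpace ℝ V] : (V × V) ≃L[ℝ] (V × V) :=
  (ContinuousLinearEquiv.refl ℝ V).prodCongr (ContinuousLinearEquiv.neg ℝ)

/-- The function `(x, t) ↦ f (t + x / 2) * conj (g (t - x / 2))`, as a map of `f`. -/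
def ambKernel (g : 𝓢(E ι, ℂ)) : 𝓢(E ι, ℂ) →L[ℂ] 𝓢(E ι × E ι, ℂ) :=
  (compCLMOfContinuousLinearEquiv ℂ (shear (E ι))).comp (tensorLeftProd (conjS g))

/-- The kernel of `u ↦ Â u ⊗ conj (Â g)` in the coordinates of the ambiguity function. -/
def metaKernel (A : Matrix.symplecticGroup ι ℝ) (g : 𝓢(E ι, ℂ)) :
    𝓢(E ι, ℂ) →L[ℂ] 𝓢(E ι × E ι, ℂ) :=
  (compCLMOfContinuousLinearEquiv ℂ (reflSnd (E ι))).comp <|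
  (partialFourier (E ι) (E ι) ℂ).comp <|
  (compCLMOfContinuousLinearEquiv ℂ (((splitCLE ι ι).symm.trans (sympCLE A).symm).trans
    (splitCLE ι ι))).comp <|
  (partialFourier (E ι) (E ι) ℂ).comp (ambKernel g)

lemma fourier_slice_metaKernel (A : Matrix.symplecticGroup ι ℝ) (f g : 𝓢(E ι, ℂ)) (x ξ : E ι) :
    𝓕 (slice x (metaKernel A g f) : E ι → ℂ) ξ =
      partialFourier (E ι) (E ι) ℂ (ambKernel g f)
        (splitCLE ι ι ((sympCLE A).symm (pt x ξ))) := by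
  set S : 𝓢(E ι × E ι, ℂ) := (compCLMOfContinuousLinearEquiv ℂ
    (((splitCLE ι ι).symm.trans (sympCLE A).symm).trans (splitCLE ι ι)))
    (partialFourier (E ι) (E ι) ℂ (ambKernel g f)) with hS
  have h : slice x (metaKernel A g f) = 𝓕⁻ (slice x S) := by
    ext t
    change partialFourier (E ι) (E ι) ℂ S (x, -t) = _
    change partialFourierFun S (x, -t) = _
    rw [partialFourierFun_eq, fourierInv_coe, Real.fourierInv_eq_fourier_neg, fourier_coe]
  rw [h, ← fourier_coe, FourierTransform.fourier_fourierInv_eq]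
  rfl

lemma amb_metaplectic {A : Matrix.symplecticGroup ι ℝ} (U : MetaplecticOperator A)
    (f g : 𝓢(E ι, ℂ)) (x ξ : E ι) :
    inner ℂ (schrodinger (pt x ξ) 0 (U.toIso (toL2 g))) (U.toIso (toL2 f)) =
      partialFourier (E ι) (E ι) ℂ (ambKernel g f)
        (splitCLE ι ι ((sympCLE A).symm (pt x ξ))) := by
  set w := (sympCLE A).symm (pt x ξ) with hw
  have e : pt x ξ = matVec A.1 w := by
    rw [← sympCLE_apply, hw, ContinuousLinearEquiv.apply_symm_apply]
  have h := U.intertwines w 0 (U.toIso (toL2 g))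
  rw [LinearIsometryEquiv.symm_apply_apply] at h
  rw [e, ← h, LinearIsometryEquiv.inner_map_map, ← pt_parts w, inner_schrodinger,
    splitCLE_apply, fstPart_pt, sndPart_pt]
  change _ = partialFourierFun (ambKernel g f) _
  rw [partialFourierFun_eq, fourier_coe]
  refine integral_congr_ae ?_
  have h1 := (measurePreserving_add_right (volume : Measure (E ι))
    ((2⁻¹ : ℝ) • fstPart w)).quasiMeasurePreserving.ae_eq_comp (toL2_coeFn f)
  have h2 := (measurePreserving_sub_right (volume : Measure (E ι))
    ((2⁻¹ : ℝ) • fstPart w)).quasiMeasurePreserving.ae_eq_comp (toL2_coeFn g)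
  filter_upwards [h1, h2] with t h1 h2
  simp only [Function.comp_apply] at h1 h2
  simp only [h1, h2]
  rfl

lemma metaKernel_spec_aux {A : Matrix.symplecticGroup ι ℝ} (U : MetaplecticOperator A)
    (f g : 𝓢(E ι, ℂ)) (x : E ι) :
    (fun t : E ι => U.toIso (toL2 f) (t + (2⁻¹ : ℝ) • x) *
      conj (U.toIso (toL2 g) (t - (2⁻¹ : ℝ) • x))) =ᵐ[volume] slice x (metaKernel A g f) := by
  have m1 : MemLp (fun t : E ι => U.toIso (toL2 f) (t + (2⁻¹ : ℝ) • x)) 2 volume :=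
    (Lp.memLp (U.toIso (toL2 f))).comp_measurePreserving
      (measurePreserving_add_right volume ((2⁻¹ : ℝ) • x))
  have m2 : MemLp (fun t : E ι => U.toIso (toL2 g) (t - (2⁻¹ : ℝ) • x)) 2 volume :=
    (Lp.memLp (U.toIso (toL2 g))).comp_measurePreserving
      (measurePreserving_sub_right volume ((2⁻¹ : ℝ) • x))
  have m3 : Integrable (fun t : E ι => U.toIso (toL2 f) (t + (2⁻¹ : ℝ) • x) *
      conj (U.toIso (toL2 g) (t - (2⁻¹ : ℝ) • x))) volume := m1.integrable_mul m2.star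
  refine ae_eq_of_fourier_eq m3 (slice x (metaKernel A g f)) fun ξ => ?_
  rw [fourier_slice_metaKernel, ← amb_metaplectic U, inner_schrodinger]

lemma ae_shear {u v : E ι → ℂ} (hu : Measurable u) (hv : Measurable v) {r : E ι × E ι → ℂ}
    (hr : Measurable r)
    (h : ∀ x : E ι, ∀ᵐ t : E ι, u (t + (2⁻¹ : ℝ) • x) * conj (v (t - (2⁻¹ : ℝ) • x)) = r (x, t)) :
    ∀ᵐ y : E ι, ∀ᵐ y' : E ι, u y * conj (v y') = r ((shear (E ι)).symm (y, y')) := by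
  have hms : MeasurableSet {p : E ι × E ι | u (shear (E ι) p).1 * conj (v (shear (E ι) p).2) =
      r p} := by
    refine measurableSet_eq_fun ?_ hr
    have hs := (shear (E ι)).continuous.measurable
    exact (hu.comp (measurable_fst.comp hs)).mul
      (Complex.continuous_conj.measurable.comp (hv.comp (measurable_snd.comp hs)))
  have h2 : ∀ᵐ p : E ι × E ι ∂((volume : Measure (E ι)).prod (volume : Measure (E ι))),
      p ∈ {p : E ι × E ι | u (shear (E ι) p).1 * conj (v (shear (E ι) p).2) = r p} :=
    (Measure.ae_prod_mem_iff_ae_ae_mem hms).2 (.of_forall h)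
  have hdet : ((shear (E ι)).symm : (E ι × E ι) →L[ℝ] (E ι × E ι)).det ≠ 0 :=
    (LinearEquiv.isUnit_det' (shear (E ι)).symm.toLinearEquiv).ne_zero
  have h3 := (MeasureTheory.Measure.ContinuousLinearMap.quasiMeasurePreserving
    (μ := (volume : Measure (E ι)).prod (volume : Measure (E ι)))
    ((shear (E ι)).symm : (E ι × E ι) →L[ℝ] (E ι × E ι)) hdet).ae h2
  have h4 : ∀ᵐ p : E ι × E ι ∂((volume : Measure (E ι)).prod (volume : Measure (E ι))),
      u p.1 * conj (v p.2) = r ((shear (E ι)).symm p) := by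
    filter_upwards [h3] with p hp
    have e : shear (E ι) ((shear (E ι)).symm p) = p := (shear (E ι)).apply_symm_apply p
    have hp' : u (shear (E ι) ((shear (E ι)).symm p)).1 *
      conj (v (shear (E ι) ((shear (E ι)).symm p)).2) = r ((shear (E ι)).symm p) := hp
    rwa [e] at hp'
  exact Measure.ae_ae_of_ae_prod h4

lemma metaKernel_spec {A : Matrix.symplecticGroup ι ℝ} (U : MetaplecticOperator A)
    (f g : 𝓢(E ι, ℂ)) : ∀ᵐ y : E ι, ∀ᵐ y' : E ι,
      U.toIso (toL2 f) y * conj (U.toIso (toL2 g) y') =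
        metaKernel A g f ((shear (E ι)).symm (y, y')) :=
  ae_shear (Lp.stronglyMeasurable (U.toIso (toL2 f))).measurable
    (Lp.stronglyMeasurable (U.toIso (toL2 g))).measurable
    (metaKernel A g f).continuous.measurable (metaKernel_spec_aux U f g)

/-- `y ↦ (y, 0)` as a restriction of Schwartz functions. -/
def restrictFst (V : Type) [NormedAddCommGroup V] [NormedSpace ℝ V] :
    𝓢(V × V, ℂ) →L[ℂ] 𝓢(V, ℂ) :=
  compCLMOfAntilipschitz ℂ (K := 1) (ContinuousLinearMap.inl ℝ V V).hasTemperateGrowth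
    (AntilipschitzWith.of_le_mul_dist fun s t => by simp [Prod.dist_eq])

lemma hasTemperateGrowth_snd (χ : 𝓢(E ι, ℂ)) :
    (fun p : E ι × E ι => χ p.2).HasTemperateGrowth :=
  χ.hasTemperateGrowth.comp (ContinuousLinearMap.snd ℝ (E ι) (E ι)).hasTemperateGrowth

/-- The integral kernel used to recover `Â f` from `Â f ⊗ conj (Â g)`. -/
def metaSection (A : Matrix.symplecticGroup ι ℝ) (g χ : 𝓢(E ι, ℂ)) :
    𝓢(E ι, ℂ) →L[ℂ] 𝓢(E ι × E ι, ℂ) :=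
  (smulLeftCLM ℂ (fun p : E ι × E ι => χ p.2)).comp
    ((compCLMOfContinuousLinearEquiv ℂ (shear (E ι)).symm).comp (metaKernel A g))

lemma metaSection_apply (A : Matrix.symplecticGroup ι ℝ) (g χ f : 𝓢(E ι, ℂ)) (y y' : E ι) :
    metaSection A g χ f (y, y') = χ y' * metaKernel A g f ((shear (E ι)).symm (y, y')) := by
  rw [metaSection, ContinuousLinearMap.comp_apply,
    smulLeftCLM_apply_apply (hasTemperateGrowth_snd χ)]
  rfl

/-- Integration in the second variable. -/
def integralSnd (V : Type) [NormedAddCommGroup V] [InnerProductSpace ℝ V] [FiniteDimensional ℝ V]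
    [MeasurableSpace V] [BorelSpace V] : 𝓢(V × V, ℂ) →L[ℂ] 𝓢(V, ℂ) :=
  (restrictFst V).comp (partialFourier V V ℂ)

lemma integralSnd_apply {V : Type} [NormedAddCommGroup V] [InnerProductSpace ℝ V]
    [FiniteDimensional ℝ V] [MeasurableSpace V] [BorelSpace V] (G : 𝓢(V × V, ℂ)) (y : V) :
    integralSnd V G y = ∫ y', G (y, y') := by
  change partialFourier V V ℂ G (y, 0) = _
  rw [partialFourier_apply]
  simp

lemma exists_inner_ne_zero {v : L2 ι} (hv : v ≠ 0) :
    ∃ χ : 𝓢(E ι, ℂ), inner ℂ v (toL2 χ) ≠ 0 := by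
  by_contra! h
  exact hv (denseRange_toL2.eq_zero_of_inner_left ℂ fun χ => h χ)

lemma inner_toLp_eq (v : L2 ι) (χ : 𝓢(E ι, ℂ)) :
    inner ℂ v (toL2 χ) = ∫ y', conj (v y') * χ y' := by
  rw [L2.inner_def]
  refine integral_congr_ae ?_
  filter_upwards [toL2_coeFn χ] with t ht
  simp only [ht, RCLike.inner_apply]
  ring

/-- A metaplectic operator maps Schwartz functions to Schwartz functions, continuously. -/
lemma exists_schwartz {A : Matrix.symplecticGroup ι ℝ} (U : MetaplecticOperator A) :
    ∃ T : 𝓢(E ι, ℂ) →L[ℂ] 𝓢(E ι, ℂ), ∀ f, toL2 (T f) = U.toIso (toL2 f) := by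
  by_cases h0 : ∀ g : 𝓢(E ι, ℂ), U.toIso (toL2 g) = 0
  · refine ⟨0, fun f => ?_⟩
    rw [h0 f, zero_apply]
    exact map_zero toL2
  push Not at h0
  obtain ⟨g, hg⟩ := h0
  obtain ⟨χ, hχ⟩ := exists_inner_ne_zero hg
  refine ⟨(inner ℂ (U.toIso (toL2 g)) (toL2 χ))⁻¹ •
    (integralSnd (E ι)).comp (metaSection A g χ), fun f => ?_⟩
  set G : 𝓢(E ι, ℂ) := ((inner ℂ (U.toIso (toL2 g)) (toL2 χ))⁻¹ •
    (integralSnd (E ι)).comp (metaSection A g χ)) f with hG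
  refine Lp.ext ?_
  filter_upwards [toL2_coeFn G, metaKernel_spec U f g] with y hy0 hy
  rw [hy0, hG]
  rw [smul_apply, smul_apply, smul_eq_mul, ContinuousLinearMap.comp_apply,
    integralSnd_apply, inv_mul_eq_iff_eq_mul₀ hχ, inner_toLp_eq, ← integral_mul_const]
  refine integral_congr_ae ?_
  filter_upwards [hy] with y' hy'
  rw [metaSection_apply, ← hy']
  ring

end Schroedinger

section Wigner

variable {ι κ : Type} [Fintype ι] [Fintype κ]

/-! ### The Wigner transform on Schwartz functions -/

section PFE

variable {V : Type} [NormedAddCommGroup V] [InnerProductSpace ℝ V] [FiniteDimensional ℝ V]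
  [MeasurableSpace V] [BorelSpace V]

lemma slice_partialFourier (x : V) (G : 𝓢(V × V, ℂ)) :
    slice x (partialFourier V V ℂ G) = 𝓕 (slice x G) := by
  ext ξ
  exact partialFourierFun_eq G (x, ξ)

variable (V) in
/-- The inverse of the partial Fourier transform. -/
def partialFourierInv : 𝓢(V × V, ℂ) →L[ℂ] 𝓢(V × V, ℂ) :=
  (compCLMOfContinuousLinearEquiv ℂ (reflSnd V)).comp (partialFourier V V ℂ)

lemma slice_partialFourierInv (x : V) (G : 𝓢(V × V, ℂ)) :
    slice x (partialFourierInv V G) = 𝓕⁻ (slice x G) := by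
  ext t
  change partialFourierFun G (x, -t) = _
  rw [partialFourierFun_eq, fourierInv_coe, Real.fourierInv_eq_fourier_neg, fourier_coe]

lemma ext_slice {G H : 𝓢(V × V, ℂ)} (h : ∀ x, slice x G = slice x H) : G = H := by
  ext ⟨x, t⟩
  exact DFunLike.congr_fun (h x) t

lemma partialFourierInv_partialFourier (G : 𝓢(V × V, ℂ)) :
    partialFourierInv V (partialFourier V V ℂ G) = G :=
  ext_slice fun x => by
    rw [slice_partialFourierInv, slice_partialFourier, FourierTransform.fourierInv_fourier_eq]

lemma partialFourier_partialFourierInv (G : 𝓢(V × V, ℂ)) :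
    partialFourier V V ℂ (partialFourierInv V G) = G :=
  ext_slice fun x => by
    rw [slice_partialFourier, slice_partialFourierInv, FourierTransform.fourier_fourierInv_eq]

end PFE

/-- `(x, t) ↦ (x + t / 2, x - t / 2)`. -/
def wignerCoord (ι : Type) [Fintype ι] : (E ι × E ι) ≃L[ℝ] (E ι × E ι) :=
  (ContinuousLinearEquiv.prodComm ℝ (E ι) (E ι)).trans (shear (E ι))

/-- The linear map with `f ⊗ conj g ↦ W(f, g)`. -/
def wignerMap : 𝓢(E (ι ⊕ ι), ℂ) →L[ℂ] 𝓢(E (ι ⊕ ι), ℂ) :=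
  (compCLMOfContinuousLinearEquiv ℂ (splitCLE ι ι)).comp <|
  (partialFourier (E ι) (E ι) ℂ).comp <|
  (compCLMOfContinuousLinearEquiv ℂ (wignerCoord ι)).comp <|
  compCLMOfContinuousLinearEquiv ℂ (splitCLE ι ι).symm

lemma wignerMap_apply (F : 𝓢(E (ι ⊕ ι), ℂ)) (z : E (ι ⊕ ι)) :
    wignerMap F z = ∫ t : E ι, Complex.exp (-(2 * π * Complex.I * inner ℝ t (sndPart z))) *
      F (pt (fstPart z + (2⁻¹ : ℝ) • t) (fstPart z - (2⁻¹ : ℝ) • t)) := by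
  refine (partialFourier_apply _ (splitCLE ι ι z)).trans (integral_congr_ae (.of_forall fun t => ?_))
  simp only [Circle.smul_def, Real.fourierChar_apply, splitCLE_apply, smul_eq_mul]
  have e : (((2 * π * -inner ℝ t (sndPart z) : ℝ) : ℂ) * Complex.I) =
      -(2 * π * Complex.I * inner ℝ t (sndPart z)) := by
    push_cast; ring
  rw [e]
  rfl

/-- The cross-Wigner distribution
`W(f, g)(x, ξ) = ∫ f(x + t / 2) conj (g(x - t / 2)) e^{-2πi t·ξ} dt`. -/
def wigner (f g : 𝓢(E ι, ℂ)) : 𝓢(E (ι ⊕ ι), ℂ) := wignerMap (tensor f (conjS g))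

lemma wigner_apply (f g : 𝓢(E ι, ℂ)) (x ξ : E ι) :
    wigner f g (pt x ξ) = ∫ t : E ι, Complex.exp (-(2 * π * Complex.I * inner ℝ t ξ)) *
      (f (x + (2⁻¹ : ℝ) • t) * conj (g (x - (2⁻¹ : ℝ) • t))) := by
  rw [wigner, wignerMap_apply]
  simp only [tensor_apply, fstPart_pt, sndPart_pt, conjS_apply]

/-- The Wigner transform as a linear bijection. -/
def wignerEquiv : 𝓢(E (ι ⊕ ι), ℂ) ≃ₗ[ℂ] 𝓢(E (ι ⊕ ι), ℂ) :=
  LinearEquiv.ofLinearMap wignerMap.toLinearMap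
    ((compCLMOfContinuousLinearEquiv ℂ (splitCLE ι ι)).comp <|
      (compCLMOfContinuousLinearEquiv ℂ (wignerCoord ι).symm).comp <|
      (partialFourierInv (E ι)).comp <|
      compCLMOfContinuousLinearEquiv ℂ (splitCLE ι ι).symm).toLinearMap
    (by
      refine LinearMap.ext fun F => ?_
      have h1 : ∀ G : 𝓢(E ι × E ι, ℂ), compCLMOfContinuousLinearEquiv ℂ (splitCLE ι ι).symm
          (compCLMOfContinuousLinearEquiv ℂ (splitCLE ι ι) G) = G := fun G => by ext; simp
      have h2 : ∀ G : 𝓢(E (ι ⊕ ι), ℂ), compCLMOfContinuousLinearEquiv ℂ (splitCLE ι ι)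
          (compCLMOfContinuousLinearEquiv ℂ (splitCLE ι ι).symm G) = G := fun G => by ext; simp
      have h3 : ∀ G : 𝓢(E ι × E ι, ℂ), compCLMOfContinuousLinearEquiv ℂ (wignerCoord ι)
          (compCLMOfContinuousLinearEquiv ℂ (wignerCoord ι).symm G) = G := fun G => by ext; simp
      simp only [wignerMap, LinearMap.comp_apply, ContinuousLinearMap.coe_coe,
        ContinuousLinearMap.comp_apply, h1, h3, partialFourier_partialFourierInv, h2,
        LinearMap.id_apply])
    (by
      refine LinearMap.ext fun F => ?_
      have h1 : ∀ G : 𝓢(E ι × E ι, ℂ), compCLMOfContinuousLinearEquiv ℂ (splitCLE ι ι).symm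
          (compCLMOfContinuousLinearEquiv ℂ (splitCLE ι ι) G) = G := fun G => by ext; simp
      have h2 : ∀ G : 𝓢(E (ι ⊕ ι), ℂ), compCLMOfContinuousLinearEquiv ℂ (splitCLE ι ι)
          (compCLMOfContinuousLinearEquiv ℂ (splitCLE ι ι).symm G) = G := fun G => by ext; simp
      have h3 : ∀ G : 𝓢(E ι × E ι, ℂ), compCLMOfContinuousLinearEquiv ℂ (wignerCoord ι).symm
          (compCLMOfContinuousLinearEquiv ℂ (wignerCoord ι) G) = G := fun G => by ext; simp
      simp only [wignerMap, LinearMap.comp_apply, ContinuousLinearMap.coe_coe,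
        ContinuousLinearMap.comp_apply, h1, h3, partialFourierInv_partialFourier, h2,
        LinearMap.id_apply])

lemma wignerEquiv_apply (F : 𝓢(E (ι ⊕ ι), ℂ)) : wignerEquiv F = wignerMap F := rfl

lemma measurePreserving_split : MeasurePreserving (splitCLE ι κ) volume volume := by
  have h1 : MeasurePreserving (fun z : E (ι ⊕ κ) => z.ofLp) volume volume :=
    PiLp.volume_preserving_ofLp (ι ⊕ κ)
  have h2 := volume_measurePreserving_sumPiEquivProdPi (fun _ : ι ⊕ κ => ℝ)
  have h3 : MeasurePreserving (fun p : (ι → ℝ) × (κ → ℝ) =>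
      ((WithLp.toLp 2 p.1 : E ι), (WithLp.toLp 2 p.2 : E κ))) volume volume :=
    (PiLp.volume_preserving_toLp ι).prod (PiLp.volume_preserving_toLp κ)
  exact h3.comp (h2.comp h1)

lemma integral_split (h : E ι × E κ → ℂ) :
    ∫ z : E (ι ⊕ κ), h (splitCLE ι κ z) = ∫ p, h p :=
  measurePreserving_split.integral_comp (splitCLE ι κ).toHomeomorph.measurableEmbedding h

lemma measurePreserving_wignerCoord : MeasurePreserving (wignerCoord ι) volume volume := by
  have h1 : MeasurePreserving (fun p : E ι × E ι => (p.1, p.2 + (2⁻¹ : ℝ) • p.1))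
      (volume.prod volume) (volume.prod volume) :=
    (MeasurePreserving.id volume).skew_product (g := fun x t => t + (2⁻¹ : ℝ) • x)
      (by fun_prop) (.of_forall fun x => (measurePreserving_add_right volume _).map_eq)
  have h2 : MeasurePreserving (fun p : E ι × E ι => (p.1, p.1 - p.2))
      (volume.prod volume) (volume.prod volume) :=
    (MeasurePreserving.id volume).skew_product (g := fun x t => x - t)
      (by fun_prop) (.of_forall fun x => (Measure.measurePreserving_sub_left volume x).map_eq)
  have h3 : MeasurePreserving (Prod.swap : E ι × E ι → E ι × E ι)
      (volume.prod volume) (volume.prod volume) := Measure.measurePreserving_swap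
  have h4 := h2.comp (h3.comp (h1.comp h3))
  have e : (wignerCoord ι : E ι × E ι → E ι × E ι) =
      (fun p => (p.1, p.1 - p.2)) ∘ Prod.swap ∘
        (fun p => (p.1, p.2 + (2⁻¹ : ℝ) • p.1)) ∘ Prod.swap := by
    ext1 p
    change (p.1 + (2⁻¹ : ℝ) • p.2, p.1 - (2⁻¹ : ℝ) • p.2) =
      (p.1 + (2⁻¹ : ℝ) • p.2, p.1 + (2⁻¹ : ℝ) • p.2 - p.2)
    have h : p.2 = (2⁻¹ : ℝ) • p.2 + (2⁻¹ : ℝ) • p.2 := by rw [← add_smul]; norm_num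
    nth_rewrite 5 [h]
    congr 1
    abel
  rw [e]
  exact h4

lemma integral_wignerCoord (h : E ι × E ι → ℂ) :
    ∫ p, h (wignerCoord ι p) = ∫ p, h p :=
  measurePreserving_wignerCoord.integral_comp (wignerCoord ι).toHomeomorph.measurableEmbedding h

lemma inner_toL2_wignerMap (F : 𝓢(E (ι ⊕ ι), ℂ)) :
    inner ℂ (toL2 (wignerMap F)) (toL2 (wignerMap F)) = inner ℂ (toL2 F) (toL2 F) := by
  set H : 𝓢(E ι × E ι, ℂ) := compCLMOfContinuousLinearEquiv ℂ (splitCLE ι ι).symm F with hH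
  set G : 𝓢(E ι × E ι, ℂ) := compCLMOfContinuousLinearEquiv ℂ (wignerCoord ι) H with hG
  set K : 𝓢(E ι × E ι, ℂ) := partialFourier (E ι) (E ι) ℂ G with hK
  have hF : ∀ z, F z = H (splitCLE ι ι z) := fun z => by simp [hH]
  have hW : ∀ z, wignerMap F z = K (splitCLE ι ι z) := fun z => rfl
  have hGH : ∀ p, G p = H (wignerCoord ι p) := fun p => rfl
  have hint : ∀ L : 𝓢(E ι × E ι, ℂ), Integrable (fun p => conj (L p) * L p)
      ((volume : Measure (E ι)).prod (volume : Measure (E ι))) := fun L => by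
    have h1 := compCLMOfContinuousLinearEquiv ℂ (splitCLE ι ι) L |>.memLp 2 volume
    exact (measurePreserving_split.integrable_comp_emb
      (splitCLE ι ι).toHomeomorph.measurableEmbedding).1 (h1.star.integrable_mul h1)
  rw [inner_toL2, inner_toL2]
  simp_rw [hF, hW]
  rw [integral_split (fun p => conj (K p) * K p), integral_split (fun p => conj (H p) * H p),
    ← integral_wignerCoord (fun p => conj (H p) * H p)]
  simp_rw [← hGH]
  refine (integral_prod _ (hint K)).trans (Eq.trans ?_ (integral_prod _ (hint G)).symm)
  refine integral_congr_ae (.of_forall fun x => ?_)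
  have h := integral_inner_fourier_fourier (slice x G) (slice x G)
  rw [← slice_partialFourier] at h
  simp only [RCLike.inner_apply, slice_apply] at h
  simp only [mul_comm (conj _)]
  exact h

lemma norm_toL2_wignerMap (F : 𝓢(E (ι ⊕ ι), ℂ)) : ‖toL2 (wignerMap F)‖ = ‖toL2 F‖ := by
  rw [norm_eq_sqrt_re_inner (𝕜 := ℂ), norm_eq_sqrt_re_inner (𝕜 := ℂ), inner_toL2_wignerMap]

/-- The Wigner transform as a unitary operator. -/
def wignerIso (ι : Type) [Fintype ι] : L2 (ι ⊕ ι) ≃ₗᵢ[ℂ] L2 (ι ⊕ ι) :=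
  LinearEquiv.extendOfIsometry wignerEquiv toL2.toLinearMap toL2.toLinearMap denseRange_toL2
    denseRange_toL2 norm_toL2_wignerMap

lemma wignerIso_toL2 (F : 𝓢(E (ι ⊕ ι), ℂ)) : wignerIso ι (toL2 F) = toL2 (wignerMap F) :=
  LinearEquiv.extendOfIsometry_eq _ _ _ _ _ _ F

/-! ### The Schrödinger representation on Schwartz functions -/

lemma hasTemperateGrowth_character {V : Type} [NormedAddCommGroup V] [InnerProductSpace ℝ V]
    (q : V) : (fun t : V => Complex.exp (2 * π * Complex.I * inner ℝ q t)).HasTemperateGrowth := by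
  have h : (fun s : ℝ => Complex.exp (2 * π * Complex.I * s)).HasTemperateGrowth := by
    have hc : ContDiff ℝ ∞ (fun s : ℝ => Complex.exp (2 * π * Complex.I * s)) :=
      Complex.contDiff_exp.comp (contDiff_const.mul Complex.ofRealCLM.contDiff)
    have hd : ∀ n : ℕ, iteratedDeriv n (fun s : ℝ => Complex.exp (2 * π * Complex.I * s)) =
        fun s : ℝ => (2 * π * Complex.I) ^ n * Complex.exp (2 * π * Complex.I * s) := by
      intro n
      induction n with
      | zero => ext s; simp
      | succ n ih =>
        rw [iteratedDeriv_succ, ih]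
        ext s
        have h1 : HasDerivAt (fun s : ℝ => 2 * π * Complex.I * (s : ℂ)) (2 * π * Complex.I) s := by
          simpa using (Complex.ofRealCLM.hasDerivAt (x := s)).const_mul (2 * π * Complex.I)
        rw [(h1.cexp.const_mul _).deriv, pow_succ]
        ring
    refine ⟨hc, fun n => ⟨0, ‖(2 * π * Complex.I : ℂ) ^ n‖, fun s => ?_⟩⟩
    have e : Complex.exp (2 * π * Complex.I * s) =
        Complex.exp ((2 * π * s : ℝ) * Complex.I) := by
      congr 1; push_cast; ring
    rw [norm_iteratedFDeriv_eq_norm_iteratedDeriv, hd, norm_mul, e,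
      Complex.norm_exp_ofReal_mul_I]
    simp
  exact h.comp (Function.hasTemperateGrowth_inner_right q)

lemma schrodingerS_shift (p : E ι) : (fun t : E ι => t - p).HasTemperateGrowth := by fun_prop

/-- The Schrödinger representation on Schwartz functions. -/
def schrodingerS (z : E (ι ⊕ ι)) (τ : ℝ) : 𝓢(E ι, ℂ) →L[ℂ] 𝓢(E ι, ℂ) :=
  (Complex.exp (2 * π * Complex.I * τ) *
      Complex.exp (-(π * Complex.I * inner ℝ (fstPart z) (sndPart z)))) •
  (smulLeftCLM ℂ (fun t : E ι => Complex.exp (2 * π * Complex.I * inner ℝ (sndPart z) t))).comp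
  (compCLMOfAntilipschitz ℂ (K := 1) (schrodingerS_shift (fstPart z))
    (AntilipschitzWith.of_le_mul_dist fun s t => by simp))

lemma schrodingerS_apply (z : E (ι ⊕ ι)) (τ : ℝ) (f : 𝓢(E ι, ℂ)) (t : E ι) :
    schrodingerS z τ f t = Complex.exp (2 * π * Complex.I * τ) *
      Complex.exp (-(π * Complex.I * inner ℝ (fstPart z) (sndPart z))) *
      (Complex.exp (2 * π * Complex.I * inner ℝ (sndPart z) t) * f (t - fstPart z)) := by
  rw [schrodingerS, smul_apply, smul_apply, ContinuousLinearMap.comp_apply,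
    smulLeftCLM_apply_apply (hasTemperateGrowth_character _)]
  rfl

lemma toL2_schrodingerS (z : E (ι ⊕ ι)) (τ : ℝ) (f : 𝓢(E ι, ℂ)) :
    schrodinger z τ (toL2 f) = toL2 (schrodingerS z τ f) := by
  refine Lp.ext ?_
  have h := (measurePreserving_sub_right (volume : Measure (E ι))
    (fstPart z)).quasiMeasurePreserving.ae_eq_comp (toL2_coeFn f)
  filter_upwards [schrodinger_coeFn z τ (toL2 f), toL2_coeFn (schrodingerS z τ f), h]
    with t h1 h2 h3
  simp only [Function.comp_apply] at h3
  rw [h1, h2, schrodingerS_apply, h3]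

lemma norm_phase (z : E (ι ⊕ ι)) (τ : ℝ) (t : E ι) (c : ℂ) :
    ‖Complex.exp (2 * π * Complex.I * τ) *
      Complex.exp (-(π * Complex.I * inner ℝ (fstPart z) (sndPart z))) *
      (Complex.exp (2 * π * Complex.I * inner ℝ (sndPart z) t) * c)‖ = ‖c‖ := by
  have e : Complex.exp (2 * π * Complex.I * τ) *
      Complex.exp (-(π * Complex.I * inner ℝ (fstPart z) (sndPart z))) *
      (Complex.exp (2 * π * Complex.I * inner ℝ (sndPart z) t) * c) =
      Complex.exp ((2 * π * τ - π * inner ℝ (fstPart z) (sndPart z) +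
        2 * π * inner ℝ (sndPart z) t : ℝ) * Complex.I) * c := by
    rw [← mul_assoc, ← Complex.exp_add, ← Complex.exp_add]
    congr 2
    push_cast
    ring
  rw [e, norm_mul, Complex.norm_exp_ofReal_mul_I, one_mul]

lemma norm_schrodinger_sub (z : E (ι ⊕ ι)) (τ : ℝ) (u v : L2 ι) :
    ‖schrodinger z τ u - schrodinger z τ v‖ = ‖u - v‖ := by
  rw [Lp.norm_def, Lp.norm_def]
  congr 1
  have h := measurePreserving_sub_right (volume : Measure (E ι)) (fstPart z)
  rw [← eLpNorm_comp_measurePreserving (Lp.aestronglyMeasurable (u - v)) h]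
  refine eLpNorm_congr_norm_ae ?_
  filter_upwards [schrodinger_coeFn z τ u, schrodinger_coeFn z τ v,
    Lp.coeFn_sub (schrodinger z τ u) (schrodinger z τ v),
    h.quasiMeasurePreserving.ae_eq_comp (Lp.coeFn_sub u v)] with t h1 h2 h3 h4
  rw [h3, h4, Pi.sub_apply, h1, h2, ← mul_sub, ← mul_sub, norm_phase]
  rfl

lemma continuous_schrodinger (z : E (ι ⊕ ι)) (τ : ℝ) :
    Continuous (schrodinger z τ : L2 ι → L2 ι) :=
  (Isometry.of_dist_eq fun u v => by
    rw [dist_eq_norm, dist_eq_norm, norm_schrodinger_sub]).continuous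

/-! ### The metaplectic operator of the Wigner distribution -/

variable [DecidableEq ι]

/-- The symplectic matrix with rows `[1/2, 1/2, 0, 0]`, `[0, 0, 1/2, -1/2]`, `[0, 0, 1, 1]`,
`[-1, 1, 0, 0]`. -/
def wignerMatrix (ι : Type) [Fintype ι] [DecidableEq ι] : Matrix.symplecticGroup (ι ⊕ ι) ℝ :=
  ⟨Matrix.fromBlocks
    (Matrix.fromBlocks ((2⁻¹ : ℝ) • 1) ((2⁻¹ : ℝ) • 1) 0 0)
    (Matrix.fromBlocks 0 0 ((2⁻¹ : ℝ) • 1) (-((2⁻¹ : ℝ) • 1)))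
    (Matrix.fromBlocks 0 0 (-1) 1)
    (Matrix.fromBlocks 1 1 0 0), by
  rw [SymplecticGroup.mem_iff, Matrix.J]
  simp only [Matrix.fromBlocks_transpose, Matrix.fromBlocks_multiply]
  simp [Matrix.fromBlocks_multiply, ← Matrix.fromBlocks_one,
    Matrix.fromBlocks_add, Matrix.fromBlocks_neg, ← add_smul]
  rw [← neg_add, ← add_smul]
  norm_num⟩

lemma inner_pt (x x' : E ι) (y y' : E κ) :
    inner ℝ (pt x y) (pt x' y') = inner ℝ x x' + inner ℝ y y' := by
  simp [PiLp.inner_apply, pt]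

lemma pt_sub_pt (x x' : E ι) (y y' : E κ) : pt x y - pt x' y' = pt (x - x') (y - y') := by
  ext (i | i) <;> simp [pt]

lemma matVec_wignerMatrix (a b α β : E ι) :
    matVec (wignerMatrix ι).1 (pt (pt a b) (pt α β)) =
      pt (pt ((2⁻¹ : ℝ) • (a + b)) ((2⁻¹ : ℝ) • (α - β))) (pt (α + β) (b - a)) := by
  ext ((i | i) | (i | i)) <;>
  simp [matVec, wignerMatrix, pt, Matrix.mulVec_eq_sum, Matrix.one_apply] <;>
  ring

lemma wignerMap_schrodingerS (z : E ((ι ⊕ ι) ⊕ (ι ⊕ ι))) (τ : ℝ) (F : 𝓢(E (ι ⊕ ι), ℂ)) :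
    wignerMap (schrodingerS z τ F) =
      schrodingerS (matVec (wignerMatrix ι).1 z) τ (wignerMap F) := by
  obtain ⟨a, b, α, β, rfl⟩ : ∃ a b α β : E ι, z = pt (pt a b) (pt α β) :=
    ⟨fstPart (fstPart z), sndPart (fstPart z), fstPart (sndPart z), sndPart (sndPart z), by
      simp only [pt_parts]⟩
  ext w
  obtain ⟨x, ξ, rfl⟩ : ∃ x ξ : E ι, w = pt x ξ := ⟨fstPart w, sndPart w, (pt_parts w).symm⟩
  rw [schrodingerS_apply, wignerMap_apply, wignerMap_apply, matVec_wignerMatrix]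
  simp only [schrodingerS_apply, fstPart_pt, sndPart_pt, inner_pt, pt_sub_pt]
  rw [← integral_add_right_eq_self (μ := volume) _ (a - b), ← integral_const_mul,
    ← integral_const_mul]
  refine integral_congr_ae (.of_forall fun t => ?_)
  have e1 : x + (2⁻¹ : ℝ) • (t + (a - b)) - a = x - (2⁻¹ : ℝ) • (a + b) + (2⁻¹ : ℝ) • t := by
    module
  have e2 : x - (2⁻¹ : ℝ) • (t + (a - b)) - b = x - (2⁻¹ : ℝ) • (a + b) - (2⁻¹ : ℝ) • t := by
    module
  simp only [e1, e2]
  simp only [← mul_assoc, ← Complex.exp_add]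
  congr 2
  simp only [inner_add_left, inner_add_right, inner_sub_left, inner_sub_right, inner_smul_left,
    inner_smul_right, real_inner_comm α, real_inner_comm β, real_inner_comm ξ,
    RCLike.conj_to_real]
  push_cast
  ring

/-- The metaplectic operator `Â_{1/2}` with `Â_{1/2} (f ⊗ conj g) = W(f, g)`. -/
def wignerMetaplectic (ι : Type) [Fintype ι] [DecidableEq ι] :
    MetaplecticOperator (wignerMatrix ι) where
  toIso := wignerIso ι
  intertwines z τ u := by
    obtain ⟨w, rfl⟩ := (wignerIso ι).surjective u
    rw [LinearIsometryEquiv.symm_apply_apply]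
    refine denseRange_toL2.induction_on (p := fun w => wignerIso ι (schrodinger z τ w) =
      schrodinger (matVec (wignerMatrix ι).1 z) τ (wignerIso ι w)) w ?_ fun F => ?_
    · exact isClosed_eq ((wignerIso ι).continuous.comp (continuous_schrodinger z τ))
        ((continuous_schrodinger _ τ).comp (wignerIso ι).continuous)
    · rw [toL2_schrodingerS, wignerIso_toL2, wignerIso_toL2, toL2_schrodingerS,
        wignerMap_schrodingerS]

end Wigner

section Quantization

variable {ι κ : Type} [Fintype ι] [Fintype κ]

/-! ### Duality and convolution -/

/-- The pairing of a tempered distribution with a Schwartz function, linear in the distribution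
and conjugate-linear in the function: it extends `∫ f(x) conj (φ(x)) dx`. -/
def bracket (a : 𝓢'(E ι, ℂ)) (φ : 𝓢(E ι, ℂ)) : ℂ := a (conjS φ)

lemma ext_bracket {a b : 𝓢'(E ι, ℂ)} (h : ∀ φ, bracket a φ = bracket b φ) : a = b := by
  ext φ
  simpa [bracket] using h (conjS φ)

/-- The function `t ↦ Φ(-t)`. -/
def reflS : 𝓢(E ι, ℂ) →L[ℂ] 𝓢(E ι, ℂ) :=
  compCLMOfContinuousLinearEquiv ℂ (ContinuousLinearEquiv.neg ℝ)

/-- The convolution of a Schwartz function with the reflection of `Φ`. -/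
def convRefl (Φ : 𝓢(E ι, ℂ)) : 𝓢(E ι, ℂ) →L[ℂ] 𝓢(E ι, ℂ) :=
  SchwartzMap.convolution (ContinuousLinearMap.mul ℂ ℂ) (reflS Φ)

lemma convRefl_apply (Φ ψ : 𝓢(E ι, ℂ)) (x : E ι) : convRefl Φ ψ x = ∫ y, Φ (y - x) * ψ y := by
  rw [convRefl, SchwartzMap.convolution_apply, MeasureTheory.convolution_def,
    ← integral_sub_left_eq_self _ volume x]
  refine integral_congr_ae (.of_forall fun y => ?_)
  simp [reflS]

/-- The convolution of a tempered distribution and a Schwartz function. -/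
def conv (a : 𝓢'(E ι, ℂ)) (Φ : 𝓢(E ι, ℂ)) : 𝓢'(E ι, ℂ) :=
  PointwiseConvergenceCLM.precomp ℂ (convRefl Φ) a

lemma conv_apply (a : 𝓢'(E ι, ℂ)) (Φ ψ : 𝓢(E ι, ℂ)) : conv a Φ ψ = a (convRefl Φ ψ) := rfl

/-! ### The action of metaplectic operators on Schwartz functions and tempered distributions -/

section Action

variable [DecidableEq ι] {A : Matrix.symplecticGroup ι ℝ}

namespace MetaplecticOperator

/-- The restriction of a metaplectic operator to the Schwartz space. -/
def onSchwartz (U : MetaplecticOperator A) : 𝓢(E ι, ℂ) →L[ℂ] 𝓢(E ι, ℂ) :=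
  (exists_schwartz U).choose

lemma toL2_onSchwartz (U : MetaplecticOperator A) (f : 𝓢(E ι, ℂ)) :
    toL2 (U.onSchwartz f) = U.toIso (toL2 f) := (exists_schwartz U).choose_spec f

/-- The extension of a metaplectic operator to tempered distributions:
`⟨Â a, φ⟩ = ⟨a, Â⁻¹ φ⟩`. -/
def onTempered (U : MetaplecticOperator A) : 𝓢'(E ι, ℂ) →L[ℂ] 𝓢'(E ι, ℂ) :=
  PointwiseConvergenceCLM.precomp ℂ
    ((conjS (V := E ι)).comp ((U.inv.onSchwartz).comp (conjS (V := E ι))))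

lemma bracket_onTempered (U : MetaplecticOperator A) (a : 𝓢'(E ι, ℂ)) (φ : 𝓢(E ι, ℂ)) :
    bracket (U.onTempered a) φ = bracket a (U.inv.onSchwartz φ) := by
  change a (conjS (U.inv.onSchwartz (conjS (conjS φ)))) = _
  rw [conjS_conjS]
  rfl

/-- On Schwartz functions the two actions agree. -/
lemma onTempered_toTemperedDistribution (U : MetaplecticOperator A) (f : 𝓢(E ι, ℂ)) :
    U.onTempered (toTemperedDistributionCLM (E ι) ℂ volume f) =
      toTemperedDistributionCLM (E ι) ℂ volume (U.onSchwartz f) := by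
  have h : ∀ f φ : 𝓢(E ι, ℂ), bracket (toTemperedDistributionCLM (E ι) ℂ volume f) φ =
      inner ℂ (toL2 φ) (toL2 f) := fun f φ => by
    rw [inner_toL2, bracket]
    exact toTemperedDistributionCLM_apply_apply volume f (conjS φ)
  refine ext_bracket fun φ => ?_
  rw [bracket_onTempered, h, h, toL2_onSchwartz, toL2_onSchwartz,
    ← LinearIsometryEquiv.inner_map_map U.toIso]
  congr 1
  exact U.toIso.apply_symm_apply _

end MetaplecticOperator

end Action

/-! ### Quantizations -/

/-- The operator `f ↦ T_a f` with `⟨T_a f, g⟩ = ⟨a, T (g ⊗ conj f)⟩`. -/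
def quantization (T : 𝓢(E (ι ⊕ ι), ℂ) →L[ℂ] 𝓢(E (ι ⊕ ι), ℂ)) (a : 𝓢'(E (ι ⊕ ι), ℂ)) :
    𝓢(E ι, ℂ) →L[ℂ] 𝓢'(E ι, ℂ) where
  toFun f := PointwiseConvergenceCLM.precomp ℂ
    ((conjS (V := E (ι ⊕ ι))).comp (T.comp ((tensorLeft (conjS f)).comp (conjS (V := E ι))))) a
  map_add' f g := by
    ext h
    change a (conjS (T (tensorRight (conjS h) (conjS (f + g))))) =
      a (conjS (T (tensorRight (conjS h) (conjS f)))) +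
        a (conjS (T (tensorRight (conjS h) (conjS g))))
    simp only [map_add]
  map_smul' c f := by
    ext h
    change a (conjS (T (tensorRight (conjS h) (conjS (c • f))))) =
      c * a (conjS (T (tensorRight (conjS h) (conjS f))))
    simp
  cont := by
    refine PointwiseConvergenceCLM.continuous_of_continuous_eval fun h => ?_
    change Continuous fun f => a (conjS (T (tensorRight (conjS h) (conjS f))))
    exact (map_continuous a).comp <| conjS.continuous.comp <| T.continuous.comp <|
      (tensorRight (conjS h)).continuous.comp conjS.continuous

lemma bracket_quantization (T : 𝓢(E (ι ⊕ ι), ℂ) →L[ℂ] 𝓢(E (ι ⊕ ι), ℂ))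
    (a : 𝓢'(E (ι ⊕ ι), ℂ)) (f g : 𝓢(E ι, ℂ)) :
    bracket (quantization T a f) g = bracket a (T (tensor g (conjS f))) := by
  change a (conjS (T (tensor (conjS (conjS g)) (conjS f)))) = _
  rw [conjS_conjS]
  rfl

/-- The Weyl operator with symbol `σ`: `⟨Op_w(σ) f, g⟩ = ⟨σ, W(g, f)⟩`. -/
def weylOp (σ : 𝓢'(E (ι ⊕ ι), ℂ)) : 𝓢(E ι, ℂ) →L[ℂ] 𝓢'(E ι, ℂ) := quantization wignerMap σ

lemma bracket_weylOp (σ : 𝓢'(E (ι ⊕ ι), ℂ)) (f g : 𝓢(E ι, ℂ)) :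
    bracket (weylOp σ f) g = bracket σ (wigner g f) := bracket_quantization _ σ f g

section Metaplectic

variable [DecidableEq ι] {A : Matrix.symplecticGroup (ι ⊕ ι) ℝ}

/-- The metaplectic Wigner distribution `W_A(f, g) = Â (f ⊗ conj g)`. -/
def metaWigner (U : MetaplecticOperator A) (f g : 𝓢(E ι, ℂ)) : 𝓢(E (ι ⊕ ι), ℂ) :=
  U.onSchwartz (tensor f (conjS g))

/-- For the operator `Â_{1/2}` one obtains the Wigner distribution. -/
lemma metaWigner_wignerMetaplectic (f g : 𝓢(E ι, ℂ)) :
    metaWigner (wignerMetaplectic ι) f g = wigner f g :=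
  toL2_injective <| ((wignerMetaplectic ι).toL2_onSchwartz _).trans (wignerIso_toL2 _)

/-- The metaplectic pseudodifferential operator with symbol `a`:
`⟨Op_A(a) f, g⟩ = ⟨a, W_A(g, f)⟩`. -/
def metaOp (U : MetaplecticOperator A) (a : 𝓢'(E (ι ⊕ ι), ℂ)) : 𝓢(E ι, ℂ) →L[ℂ] 𝓢'(E ι, ℂ) :=
  quantization U.onSchwartz a

lemma bracket_metaOp (U : MetaplecticOperator A) (a : 𝓢'(E (ι ⊕ ι), ℂ)) (f g : 𝓢(E ι, ℂ)) :
    bracket (metaOp U a f) g = bracket a (metaWigner U g f) := bracket_quantization _ a f g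

/-- The metaplectic localization operator with symbol `a` and windows `φ₁`, `φ₂`:
`Op_A(a * W_A(φ₂, φ₁))`. -/
def locOp (U : MetaplecticOperator A) (a : 𝓢'(E (ι ⊕ ι), ℂ)) (φ₁ φ₂ : 𝓢(E ι, ℂ)) :
    𝓢(E ι, ℂ) →L[ℂ] 𝓢'(E ι, ℂ) :=
  metaOp U (conv a (metaWigner U φ₂ φ₁))

end Metaplectic

end Quantization

end ALoc

end

/-! That σ is a Weyl symbol is a duality computation. Put b = a * W_A(φ₂, φ₁). Moving the two
metaplectic operators to the test function turns ⟨Â_{1/2} Â⁻¹ b, W(g, f)⟩ into ⟨b, Â Â_{1/2}⁻¹ W(g,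
f)⟩. Since W(g, f) = Â_{1/2}(g ⊗ conj f), the operator Â_{1/2} cancels and ⟨b, W_A(g, f)⟩ remains.
This is `weylOp_onTempered`, valid for every tempered b.

Uniqueness (`weylOp_injective`) is the longer half. The Wigner transform F ↦ W is a bijection of the
Schwartz space that sends g ⊗ conj f to W(g, f). So it suffices that a continuous functional T on
Schwartz functions of two groups of variables vanishes as soon as it vanishes on all tensor products
f ⊗ g (`eq_zero_of_tensor`).

For this, T is first regularised. With Schwartz functions χ and Φ, the map F ↦ χ · 𝓕(Φ F) has a
Schwartz integral kernel, hence is continuous from the L² norm to the Schwartz topology, and F ↦ T(χ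
· 𝓕(Φ F)) is bounded in L² (`exists_bound_mulS_fourier_mulS`). By Riesz it is integration against
conj u for some u in L². Now let χ, Φ and a third function θ be tensor products. Modulations,
products and Fourier transforms of tensor products are tensor products, so the regularised
functional vanishes on every character times θ. Thus the Fourier transform of conj u · θ is zero,
hence conj u · θ = 0 almost everywhere, and T(χ · 𝓕(Φ θ F)) = 0 for every F (`eq_zero_of_modulate`).

The auxiliary factors are then removed one after another: dilated tensor cutoffs with value 1 at the
origin converge to the identity in the Schwartz topology (`tendsto_mulS_dilate`,
`eq_zero_of_mulS_tensor`), and the Fourier transform is onto. -/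

noncomputable section

namespace ALoc

/-! ### Pointwise products and cutoffs -/

section Cutoff

variable {V : Type} [NormedAddCommGroup V] [NormedSpace ℝ V]

/-- Multiplication by a Schwartz function. -/
def mulS (χ : 𝓢(V, ℂ)) : 𝓢(V, ℂ) →L[ℂ] 𝓢(V, ℂ) := smulLeftCLM ℂ χ

@[simp] lemma mulS_apply (χ F : 𝓢(V, ℂ)) (x : V) : mulS χ F x = χ x * F x :=
  smulLeftCLM_apply_apply χ.hasTemperateGrowth F x

/-- The dilation `x ↦ F (r x)`. -/
def dilate (r : ℝˣ) : 𝓢(V, ℂ) →L[ℂ] 𝓢(V, ℂ) :=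
  compCLMOfContinuousLinearEquiv ℂ (ContinuousLinearEquiv.smulLeft r)

@[simp] lemma dilate_apply (r : ℝˣ) (F : 𝓢(V, ℂ)) (x : V) : dilate r F x = F ((r : ℝ) • x) := rfl

/-- Mean value inequality. It handles the underived term in the cutoff estimate, where the
difference from 1 is small only near the origin. -/
lemma norm_apply_sub_apply_zero_le (θ : 𝓢(V, ℂ)) (x : V) :
    ‖θ x - θ 0‖ ≤ SchwartzMap.seminorm ℂ 0 1 θ * ‖x‖ := by
  have h := Convex.norm_image_sub_le_of_norm_fderiv_le (𝕜 := ℝ) (f := θ) (s := Set.univ)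
    (C := SchwartzMap.seminorm ℂ 0 1 θ) (fun x _ => θ.differentiableAt) (fun x _ => by
      rw [← norm_iteratedFDeriv_one]
      exact θ.norm_iteratedFDeriv_le_seminorm ℂ 1 x) convex_univ (Set.mem_univ 0) (Set.mem_univ x)
  simpa using h

/-- For i = 0 the mean value inequality gives r‖x‖ times a bound on the first derivative of θ. For i
≥ 1 the constant 1 disappears and the chain rule gives r ^ i ≤ r. The index `max i 1` and the factor
1 + ‖x‖ cover both cases at once. -/
lemma norm_iteratedFDeriv_dilate_sub_one_le (θ : 𝓢(V, ℂ)) (h0 : θ 0 = 1) {r : ℝ} (hr0 : 0 ≤ r)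
    (hr1 : r ≤ 1) (i : ℕ) (x : V) :
    ‖iteratedFDeriv ℝ i (fun x => θ (r • x) - 1) x‖ ≤
      r * (1 + ‖x‖) * SchwartzMap.seminorm ℂ 0 (max i 1) θ := by
  rcases Nat.eq_zero_or_pos i with rfl | hi
  · rw [norm_iteratedFDeriv_zero, ← h0]
    refine (norm_apply_sub_apply_zero_le θ _).trans ?_
    rw [norm_smul, Real.norm_of_nonneg hr0, mul_comm]
    simp only [Nat.zero_le, sup_of_le_right]
    gcongr
    linarith
  · have hθ : ContDiff ℝ i (fun x => θ (r • x)) :=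
      (θ.smooth i).comp (contDiff_const_smul r)
    have e : iteratedFDeriv ℝ i (fun x => θ (r • x) - 1) x =
        iteratedFDeriv ℝ i (fun x => θ (r • x)) x := by
      rw [fun_iteratedFDeriv_sub_apply hθ.contDiffAt contDiff_const.contDiffAt,
        iteratedFDeriv_const_of_ne hi.ne']
      simp
    have hc : (fun x => θ (r • x)) = θ ∘ (r • ContinuousLinearMap.id ℝ V) := by ext; simp
    rw [e, hc, ContinuousLinearMap.iteratedFDeriv_comp_right _ (θ.smooth i) _ le_rfl, max_eq_left hi]
    refine (ContinuousMultilinearMap.norm_compContinuousLinearMap_le _ _).trans ?_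
    have hn : ‖r • ContinuousLinearMap.id ℝ V‖ ≤ r := by
      rw [norm_smul, Real.norm_of_nonneg hr0]
      exact mul_le_of_le_one_right hr0 ContinuousLinearMap.norm_id_le
    have hp : ∏ _j : Fin i, ‖r • ContinuousLinearMap.id ℝ V‖ ≤ r * (1 + ‖x‖) := by
      rw [Finset.prod_const, Finset.card_univ, Fintype.card_fin]
      calc ‖r • ContinuousLinearMap.id ℝ V‖ ^ i ≤ r ^ i := by gcongr
        _ ≤ r ^ 1 := pow_le_pow_of_le_one hr0 hr1 hi
        _ ≤ _ := by nlinarith [norm_nonneg x]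
    rw [mul_comm]
    exact mul_le_mul hp (θ.norm_iteratedFDeriv_le_seminorm ℂ i _) (norm_nonneg _) (by positivity)

/-- Leibniz rule for (θ(r x) - 1) F(x): each derivative of the first factor costs at most a constant
times r (1 + ‖x‖), and the additional power of ‖x‖ is absorbed by the seminorm of F with index k +
1. The constant may depend on F, since only convergence at a fixed F is needed. -/
lemma seminorm_mulS_dilate_sub_le (θ : 𝓢(V, ℂ)) (h0 : θ 0 = 1) (k n : ℕ) (F : 𝓢(V, ℂ)) :
    ∃ C : ℝ, ∀ r : ℝˣ, 0 ≤ (r : ℝ) → (r : ℝ) ≤ 1 →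
      SchwartzMap.seminorm ℂ k n (mulS (dilate r θ) F - F) ≤ r * C := by
  refine ⟨∑ i ∈ Finset.range (n + 1), (n.choose i : ℝ) * SchwartzMap.seminorm ℂ 0 (max i 1) θ *
    (SchwartzMap.seminorm ℂ k (n - i) F + SchwartzMap.seminorm ℂ (k + 1) (n - i) F),
    fun r hr0 hr1 => ?_⟩
  refine SchwartzMap.seminorm_le_bound ℂ k n _ (by positivity) fun x => ?_
  have e : ((mulS (dilate r θ) F - F : 𝓢(V, ℂ)) : V → ℂ) =
      fun x => (θ ((r : ℝ) • x) - 1) * F x := by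
    ext x; simp [sub_mul]
  have hθ : ContDiff ℝ n (fun x => θ ((r : ℝ) • x) - 1) :=
    ((θ.smooth n).comp (contDiff_const_smul (r : ℝ))).sub contDiff_const
  rw [e, Finset.mul_sum]
  refine (mul_le_mul_of_nonneg_left (norm_iteratedFDeriv_mul_le hθ (F.smooth n) x le_rfl)
    (by positivity)).trans ?_
  rw [Finset.mul_sum]
  refine Finset.sum_le_sum fun i _ => ?_
  have h1 := norm_iteratedFDeriv_dilate_sub_one_le θ h0 hr0 hr1 i x
  have h2 := F.le_seminorm ℂ k (n - i) x
  have h3 := F.le_seminorm ℂ (k + 1) (n - i) x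
  calc _ ≤ ‖x‖ ^ k * ((n.choose i : ℝ) * (r * (1 + ‖x‖) * SchwartzMap.seminorm ℂ 0 (max i 1) θ) *
        ‖iteratedFDeriv ℝ (n - i) F x‖) := by gcongr
    _ = r * ((n.choose i : ℝ) * SchwartzMap.seminorm ℂ 0 (max i 1) θ *
        (‖x‖ ^ k * ‖iteratedFDeriv ℝ (n - i) F x‖ +
          ‖x‖ ^ (k + 1) * ‖iteratedFDeriv ℝ (n - i) F x‖)) := by ring
    _ ≤ _ := by gcongr

/-- Cutting off by a dilated Schwartz function with value `1` at the origin approximates the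
identity. -/
lemma tendsto_mulS_dilate (θ : 𝓢(V, ℂ)) (h0 : θ 0 = 1) (F : 𝓢(V, ℂ)) (r : ℕ → ℝˣ)
    (hr0 : ∀ j, 0 ≤ (r j : ℝ)) (hr1 : ∀ j, (r j : ℝ) ≤ 1)
    (hr : Filter.Tendsto (fun j => (r j : ℝ)) Filter.atTop (nhds 0)) :
    Filter.Tendsto (fun j => mulS (dilate (r j) θ) F) Filter.atTop (nhds F) := by
  rw [(schwartz_withSeminorms ℂ V ℂ).tendsto_nhds]
  rintro ⟨k, n⟩ ε hε
  obtain ⟨C, hC⟩ := seminorm_mulS_dilate_sub_le θ h0 k n F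
  have h : Filter.Tendsto (fun j => (r j : ℝ) * C) Filter.atTop (nhds 0) := by
    simpa using hr.mul_const C
  filter_upwards [h.eventually_lt_const hε] with j hj
  exact (hC (r j) (hr0 j) (hr1 j)).trans_lt hj

/-- A Schwartz function with value `1` at the origin. -/
lemma exists_apply_zero_eq_one [FiniteDimensional ℝ V] : ∃ θ : 𝓢(V, ℂ), θ 0 = 1 := by
  -- A smooth bump transported along a linear isomorphism, which fixes the origin. Only the value at
  -- the centre matters, not the radii 1 and 2.
  have b : ContDiffBump (0 : EuclideanSpace ℝ (Fin (Module.finrank ℝ V))) := ⟨1, 2, one_pos, one_lt_two⟩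
  have h1 : HasCompactSupport (Complex.ofRealCLM ∘ b) := b.hasCompactSupport.comp_left rfl
  have h2 : ContDiff ℝ ∞ (Complex.ofRealCLM ∘ b) := Complex.ofRealCLM.contDiff.comp b.contDiff
  refine ⟨compCLMOfContinuousLinearEquiv ℂ (toEuclidean (E := V)) (h1.toSchwartzMap h2), ?_⟩
  have : b 0 = 1 := b.one_of_mem_closedBall (by simp [b.rIn_pos.le])
  simp [this]

end Cutoff

/-! ### Tensor products -/

section TensorProducts

variable {ι κ : Type} [Fintype ι] [Fintype κ]

/-- This and the next lemmas show that tensor products are stable under products, dilations, the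
Fourier transform and modulations, so a functional that vanishes on tensor products still vanishes
after any of these operations. -/
lemma mulS_tensor (a f : 𝓢(E ι, ℂ)) (b g : 𝓢(E κ, ℂ)) :
    mulS (tensor a b) (tensor f g) = tensor (mulS a f) (mulS b g) := by
  ext z
  simp only [mulS_apply, tensor_apply]
  ring

lemma dilate_tensor (r : ℝˣ) (f : 𝓢(E ι, ℂ)) (g : 𝓢(E κ, ℂ)) :
    dilate r (tensor f g) = tensor (dilate r f) (dilate r g) := rfl

/-- The inner product is the sum of those of the two components, so the character factors and the
integral over the product splits. -/
lemma fourier_tensor (f : 𝓢(E ι, ℂ)) (g : 𝓢(E κ, ℂ)) : 𝓕 (tensor f g) = tensor (𝓕 f) (𝓕 g) := by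
  classical
  ext w
  rw [tensor_apply, fourier_coe, fourier_coe, fourier_coe, Real.fourier_eq, Real.fourier_eq,
    Real.fourier_eq, ← integral_prod_mul]
  refine Eq.trans ?_ (integral_split _)
  refine integral_congr_ae (.of_forall fun z => ?_)
  have h : inner ℝ z w = inner ℝ (fstPart z) (fstPart w) + inner ℝ (sndPart z) (sndPart w) := by
    rw [← inner_pt, pt_parts, pt_parts]
  simp only [splitCLE_apply, tensor_apply, h, Circle.smul_def, smul_eq_mul, neg_add,
    AddChar.map_add_eq_mul, Circle.coe_mul]
  exact mul_mul_mul_comm _ _ _ _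

/-- The product with the character `t ↦ e^{2πi q·t}`. -/
def modulate (q : E ι) : 𝓢(E ι, ℂ) →L[ℂ] 𝓢(E ι, ℂ) :=
  smulLeftCLM ℂ fun t : E ι => Complex.exp (2 * π * Complex.I * inner ℝ q t)

lemma modulate_apply (q : E ι) (f : 𝓢(E ι, ℂ)) (t : E ι) :
    modulate q f t = Complex.exp (2 * π * Complex.I * inner ℝ q t) * f t :=
  smulLeftCLM_apply_apply (hasTemperateGrowth_character q) f t

lemma modulate_tensor (q : E (ι ⊕ κ)) (f : 𝓢(E ι, ℂ)) (g : 𝓢(E κ, ℂ)) :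
    modulate q (tensor f g) = tensor (modulate (fstPart q) f) (modulate (sndPart q) g) := by
  classical
  ext z
  have h : inner ℝ q z = inner ℝ (fstPart q) (fstPart z) + inner ℝ (sndPart q) (sndPart z) := by
    rw [← inner_pt, pt_parts, pt_parts]
  simp only [modulate_apply, tensor_apply, h, Complex.ofReal_add, mul_add, Complex.exp_add]
  ring

/-- If a continuous functional vanishes on all products of `F` with tensor products, it vanishes
at `F`. -/
lemma eq_zero_of_mulS_tensor {T : 𝓢(E (ι ⊕ κ), ℂ) →L[ℂ] ℂ} {F : 𝓢(E (ι ⊕ κ), ℂ)}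
    (h : ∀ f g, T (mulS (tensor f g) F) = 0) : T F = 0 := by
  obtain ⟨θ, hθ⟩ := exists_apply_zero_eq_one (V := E ι)
  obtain ⟨η, hη⟩ := exists_apply_zero_eq_one (V := E κ)
  -- The cutoff is itself a tensor product, and so are its dilations; hence the hypothesis applies
  -- along the whole sequence that converges to F.
  have ht := tendsto_mulS_dilate (tensor θ η) (by
    have h1 : fstPart (0 : E (ι ⊕ κ)) = 0 := rfl
    have h2 : sndPart (0 : E (ι ⊕ κ)) = 0 := rfl
    rw [tensor_apply, h1, h2, hθ, hη, one_mul]) F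
    -- The scale 1 / (j + 1) is invertible, lies in (0, 1] from j = 0 on and tends to 0, as the
    -- cutoff lemma requires.
    (fun j => Units.mk0 (1 / ((j : ℝ) + 1)) (by positivity))
    (fun j => by simp only [Units.val_mk0]; positivity)
    (fun j => by
      rw [Units.val_mk0, div_le_one (by positivity)]
      linarith [(j.cast_nonneg : (0 : ℝ) ≤ j)])
    tendsto_one_div_add_atTop_nhds_zero_nat
  refine tendsto_nhds_unique ((T.continuous.tendsto F).comp ht) ?_
  simp only [Function.comp_def, dilate_tensor, h]
  exact tendsto_const_nhds

end TensorProducts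

/-! ### An `L²` bound -/

section Bound

variable {ι : Type} [Fintype ι]

/-- Cauchy–Schwarz: the weight ‖v‖ ^ p ‖Φ v‖ is square integrable, and C is its L² norm. The moments
of Φ F are thereby controlled by the L² norm of F alone. -/
lemma integral_pow_mul_norm_mul_le (Φ : 𝓢(E ι, ℂ)) (p : ℕ) : ∃ C : ℝ, 0 ≤ C ∧ ∀ F : 𝓢(E ι, ℂ),
    ∫ v, ‖v‖ ^ p * ‖mulS Φ F v‖ ≤ C * ‖toL2 F‖ := by
  have hm : MemLp (fun v => ‖v‖ ^ p * ‖Φ v‖) 2 (volume : Measure (E ι)) := by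
    have hc : Continuous fun v => ‖v‖ ^ p * ‖Φ v‖ := by fun_prop
    rw [memLp_two_iff_integrable_sq hc.aestronglyMeasurable]
    -- In the square, one factor ‖Φ v‖ is bounded by its supremum and the other makes the weight of
    -- order 2p integrable.
    refine ((Φ.integrable_pow_mul volume (2 * p)).const_mul (SchwartzMap.seminorm ℂ 0 0 Φ)).mono'
      (by fun_prop) (.of_forall fun v => ?_)
    rw [Real.norm_of_nonneg (by positivity)]
    calc (‖v‖ ^ p * ‖Φ v‖) ^ 2 = ‖Φ v‖ * (‖v‖ ^ (2 * p) * ‖Φ v‖) := by ring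
      _ ≤ _ := by gcongr; exact Φ.norm_le_seminorm ℂ v
  refine ⟨‖hm.toLp‖, norm_nonneg _, fun F => ?_⟩
  have hF : MemLp (fun v => ‖F v‖) 2 (volume : Measure (E ι)) := (F.memLp 2 volume).norm
  have e1 : ∫ v, ‖v‖ ^ p * ‖mulS Φ F v‖ = inner ℝ hm.toLp hF.toLp := by
    rw [L2.inner_def]
    refine integral_congr_ae ?_
    filter_upwards [hm.coeFn_toLp, hF.coeFn_toLp] with v h1 h2
    rw [h1, h2, mulS_apply, norm_mul]
    simp only [RCLike.inner_apply, conj_trivial]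
    ring
  have e2 : ‖hF.toLp‖ = ‖toL2 F‖ := by
    have : toL2 F = (F.memLp 2 volume).toLp := rfl
    rw [this, Lp.norm_toLp, Lp.norm_toLp, eLpNorm_norm]
  rw [e1, ← e2]
  exact real_inner_le_norm _ _

/-- The derivatives of order n of a Fourier transform are bounded by (2π)^n times the moments of
order at most n. The bound is uniform in x but has no decay; decay comes from the outer factor in
the next lemma. -/
lemma norm_iteratedFDeriv_fourier_mulS_le (Φ : 𝓢(E ι, ℂ)) (n : ℕ) : ∃ C : ℝ, 0 ≤ C ∧
    ∀ (F : 𝓢(E ι, ℂ)) (x : E ι), ‖iteratedFDeriv ℝ n (𝓕 (mulS Φ F) : 𝓢(E ι, ℂ)) x‖ ≤ C * ‖toL2 F‖ := by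
  choose C hC0 hC using integral_pow_mul_norm_mul_le Φ
  refine ⟨(2 * π) ^ n * ∑ p ∈ Finset.range (n + 1), C p, by
    have := Finset.sum_nonneg fun p (_ : p ∈ Finset.range (n + 1)) => hC0 p
    positivity, fun F x => ?_⟩
  have h := pow_mul_norm_iteratedFDeriv_fourier_le (K := ⊤) (N := ⊤) ((mulS Φ F).smooth ⊤)
      (fun k n _ _ => integrable_pow_mul_iteratedFDeriv _ (mulS Φ F) k n) (k := n) (n := 0)
      le_top le_top x
  simp only [pow_zero, one_mul, mul_one, zero_add, Finset.range_one, Finset.product_singleton,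
    Finset.sum_map, Function.Embedding.coeFn_mk, norm_iteratedFDeriv_zero] at h
  rw [fourier_coe]
  refine h.trans ?_
  rw [mul_assoc, Finset.sum_mul]
  gcongr with p
  exact hC p F

/-- Leibniz rule, with the whole weight ‖x‖ ^ k placed on χ and the uniform derivative bound used
for the Fourier transform. -/
lemma seminorm_mulS_fourier_mulS_le (χ Φ : 𝓢(E ι, ℂ)) (k n : ℕ) : ∃ C : ℝ, 0 ≤ C ∧
    ∀ F : 𝓢(E ι, ℂ), SchwartzMap.seminorm ℂ k n (mulS χ (𝓕 (mulS Φ F))) ≤ C * ‖toL2 F‖ := by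
  choose C hC0 hC using norm_iteratedFDeriv_fourier_mulS_le Φ
  have h0 : 0 ≤ ∑ i ∈ Finset.range (n + 1),
      (n.choose i : ℝ) * SchwartzMap.seminorm ℂ k i χ * C (n - i) :=
    Finset.sum_nonneg fun i _ => mul_nonneg (by positivity) (hC0 _)
  refine ⟨_, h0, fun F => SchwartzMap.seminorm_le_bound ℂ k n _ (by positivity) fun x => ?_⟩
  have e : ⇑(mulS χ (𝓕 (mulS Φ F))) = fun x => χ x * (𝓕 (mulS Φ F) : 𝓢(E ι, ℂ)) x := by
    ext x; simp
  rw [e]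
  refine (mul_le_mul_of_nonneg_left (norm_iteratedFDeriv_mul_le (χ.smooth n)
    ((𝓕 (mulS Φ F) : 𝓢(E ι, ℂ)).smooth n) x le_rfl) (by positivity)).trans ?_
  rw [Finset.mul_sum, Finset.sum_mul]
  refine Finset.sum_le_sum fun i _ => ?_
  calc _ = (n.choose i : ℝ) * (‖x‖ ^ k * ‖iteratedFDeriv ℝ i χ x‖) *
        ‖iteratedFDeriv ℝ (n - i) (𝓕 (mulS Φ F) : 𝓢(E ι, ℂ)) x‖ := by ring
    _ ≤ (n.choose i : ℝ) * SchwartzMap.seminorm ℂ k i χ * (C (n - i) * ‖toL2 F‖) := by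
      gcongr
      · exact χ.le_seminorm ℂ k i x
      · exact hC _ F x
    _ = _ := by ring

/-- The regularisation step: T is dominated by finitely many Schwartz seminorms, and each of them,
evaluated at χ · 𝓕(Φ F), is at most a multiple of the L² norm of F. This opens the way to the Riesz
representation. -/
lemma exists_bound_mulS_fourier_mulS (T : 𝓢(E ι, ℂ) →L[ℂ] ℂ) (χ Φ : 𝓢(E ι, ℂ)) :
    ∃ C : ℝ, ∀ F : 𝓢(E ι, ℂ), ‖T (mulS χ (𝓕 (mulS Φ F)))‖ ≤ C * ‖toL2 F‖ := by
  obtain ⟨s, D, -, hD⟩ := Seminorm.bound_of_continuous (schwartz_withSeminorms ℂ (E ι) ℂ)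
    ((normSeminorm ℂ ℂ).comp T.toLinearMap) (continuous_norm.comp T.continuous)
  choose C hC0 hC using seminorm_mulS_fourier_mulS_le χ Φ
  refine ⟨D * ∑ m ∈ s, C m.1 m.2, fun F => (hD _).trans ?_⟩
  rw [smul_apply, NNReal.smul_def, smul_eq_mul, mul_assoc]
  gcongr
  refine Seminorm.finset_sup_apply_le (mul_nonneg (Finset.sum_nonneg fun m _ => hC0 _ _)
    (norm_nonneg _)) fun m hm => (hC m.1 m.2 F).trans ?_
  gcongr
  exact Finset.single_le_sum (f := fun m : ℕ × ℕ => C m.1 m.2) (fun m _ => hC0 _ _) hm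

/-- A functional that is bounded in `L²` and vanishes on the modulations of `θ` vanishes on the
multiples of `θ`. -/
lemma eq_zero_of_modulate {T : 𝓢(E ι, ℂ) →ₗ[ℂ] ℂ} {C : ℝ} (hT : ∀ F, ‖T F‖ ≤ C * ‖toL2 F‖)
    {θ : 𝓢(E ι, ℂ)} (h : ∀ q, T (modulate q θ) = 0) (F : 𝓢(E ι, ℂ)) : T (mulS θ F) = 0 := by
  classical
  -- By the bound and the density of Schwartz functions, T extends to L²; u is the Riesz vector of
  -- the extension.
  set u : L2 ι := (InnerProductSpace.toDual ℂ (L2 ι)).symm (T.extendOfNorm toL2.toLinearMap)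
  have hu : ∀ F, T F = ∫ x, conj (u x) * F x := fun F => by
    rw [← inner_toLp_eq, InnerProductSpace.toDual_symm_apply]
    exact (LinearMap.extendOfNorm_eq denseRange_toL2 ⟨C, hT⟩ F).symm
  have hi : Integrable (fun x => conj (u x) * θ x) :=
    (Lp.memLp u).star.integrable_mul (θ.memLp 2 volume)
  -- T applied to θ modulated by q is the Fourier transform of conj u · θ at -q. So this integrable
  -- function has zero transform and vanishes almost everywhere.
  have hz : (fun x => conj (u x) * θ x) =ᵐ[volume] (0 : 𝓢(E ι, ℂ)) := by
    refine ae_eq_of_fourier_eq hi 0 fun ξ => ?_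
    have hr : 𝓕 ((0 : 𝓢(E ι, ℂ)) : E ι → ℂ) ξ = 0 := by simp [Real.fourier_eq]
    rw [hr, ← h (-ξ), hu, Real.fourier_eq]
    refine integral_congr_ae (.of_forall fun x => ?_)
    simp only [modulate_apply, Circle.smul_def, Real.fourierChar_apply, smul_eq_mul,
      inner_neg_left, real_inner_comm ξ x]
    rw [mul_left_comm]
    congr 3
    push_cast
    ring
  rw [hu, ← integral_zero (E ι) ℂ]
  refine integral_congr_ae ?_
  filter_upwards [hz] with x hx
  rw [mulS_apply, ← mul_assoc, hx]
  simp

end Bound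

/-! ### Uniqueness of symbols -/

section Uniqueness

variable {ι κ : Type} [Fintype ι] [Fintype κ]

/-- A tempered distribution that vanishes on tensor products is zero. -/
theorem eq_zero_of_tensor {T : 𝓢(E (ι ⊕ κ), ℂ) →L[ℂ] ℂ} (h : ∀ f g, T (tensor f g) = 0)
    (F : 𝓢(E (ι ⊕ κ), ℂ)) : T F = 0 := by
  -- The three tensor factors have different tasks: a and b, on the two sides of the Fourier
  -- transform, give the L² bound, and c carries the modulations, on which T vanishes by the
  -- stability of tensor products.
  have key : ∀ (a₁ b₁ c₁ : 𝓢(E ι, ℂ)) (a₂ b₂ c₂ : 𝓢(E κ, ℂ)) (F : 𝓢(E (ι ⊕ κ), ℂ)),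
      T (mulS (tensor a₁ a₂) (𝓕 (mulS (tensor b₁ b₂) (mulS (tensor c₁ c₂) F)))) = 0 := by
    intro a₁ b₁ c₁ a₂ b₂ c₂
    obtain ⟨C, hC⟩ := exists_bound_mulS_fourier_mulS T (tensor a₁ a₂) (tensor b₁ b₂)
    refine eq_zero_of_modulate (T := (T.comp ((mulS (tensor a₁ a₂)).comp
      ((fourierTransformCLM ℂ).comp (mulS (tensor b₁ b₂))))).toLinearMap) hC fun q => ?_
    change T (mulS (tensor a₁ a₂) (𝓕 (mulS (tensor b₁ b₂) (modulate q (tensor c₁ c₂))))) = 0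
    rw [modulate_tensor, mulS_tensor, fourier_tensor, mulS_tensor, h]
  have h2 : ∀ (a₁ : 𝓢(E ι, ℂ)) (a₂ : 𝓢(E κ, ℂ)) (F : 𝓢(E (ι ⊕ κ), ℂ)),
      T (mulS (tensor a₁ a₂) (𝓕 F)) = 0 := by
    intro a₁ a₂ F
    obtain ⟨S, hS⟩ : ∃ S : 𝓢(E (ι ⊕ κ), ℂ) →L[ℂ] ℂ, ∀ F, S F = T (mulS (tensor a₁ a₂) (𝓕 F)) :=
      ⟨T.comp ((mulS (tensor a₁ a₂)).comp (fourierTransformCLM ℂ)), fun _ => rfl⟩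
    rw [← hS]
    -- The cutoff argument is used twice: for S it brings in b, and for the continuous functional F
    -- ↦ S(b F) it brings in c.
    refine eq_zero_of_mulS_tensor fun b₁ b₂ => ?_
    rw [← ContinuousLinearMap.comp_apply]
    refine eq_zero_of_mulS_tensor fun c₁ c₂ => ?_
    rw [ContinuousLinearMap.comp_apply, hS]
    exact key a₁ b₁ c₁ a₂ b₂ c₂ F
  -- A last cutoff brings in a; every Schwartz function is a Fourier transform, so `h2` applies.
  refine eq_zero_of_mulS_tensor fun a₁ a₂ => ?_
  have h3 : 𝓕 (𝓕⁻ F : 𝓢(E (ι ⊕ κ), ℂ)) = F := FourierTransform.fourier_fourierInv_eq F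
  rw [← h3]
  exact h2 a₁ a₂ _

/-- A tempered distribution is determined by its Weyl operator. -/
theorem weylOp_injective : Function.Injective (weylOp (ι := ι)) := by
  intro σ σ' h
  have hz : ∀ F, σ (conjS (wignerMap (conjS F))) - σ' (conjS (wignerMap (conjS F))) = 0 := by
    have hc : ∀ f g : 𝓢(E ι, ℂ), conjS (tensor f g) = tensor (conjS f) (conjS g) := fun f g => by
      ext z; simp [tensor_apply]
    -- The two conjugations, one from the bracket and one inserted on the argument, make the
    -- composite complex linear, so that the difference of the two pairings is a continuous linear
    -- functional.
    let L : 𝓢(E (ι ⊕ ι), ℂ) →L[ℂ] 𝓢(E (ι ⊕ ι), ℂ) :=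
      (conjS (V := E (ι ⊕ ι))).comp (wignerMap.comp (conjS (V := E (ι ⊕ ι))))
    let T : 𝓢(E (ι ⊕ ι), ℂ) →L[ℂ] ℂ :=
      { toFun := fun F => σ (L F) - σ' (L F)
        map_add' := fun F G => by simp only [map_add]; ring
        map_smul' := fun c F => by simp only [map_smul, smul_sub, RingHom.id_apply]
        cont := ((map_continuous σ).comp L.continuous).sub
          ((map_continuous σ').comp L.continuous) }
    -- On f ⊗ g the Wigner transform of the conjugate is W(conj f, g), so each term is the pairing
    -- of a Weyl operator applied to g with conj f. The two operators agree by assumption.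
    refine fun F => eq_zero_of_tensor (T := T) (fun f g => ?_) F
    have h1 := bracket_weylOp σ g (conjS f)
    rw [h, bracket_weylOp] at h1
    have h2 : wignerMap (conjS (tensor f g)) = wigner (conjS f) g := by rw [hc, wigner]
    change σ (conjS (wignerMap (conjS (tensor f g)))) -
      σ' (conjS (wignerMap (conjS (tensor f g)))) = 0
    rw [h2]
    exact sub_eq_zero.2 h1.symm
  refine ext_bracket fun φ => ?_
  -- The Wigner transform is onto the Schwartz space, so every test function φ is reached.
  have h1 := hz (conjS (wignerEquiv.symm φ))
  rw [conjS_conjS, ← wignerEquiv_apply, LinearEquiv.apply_symm_apply] at h1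
  exact sub_eq_zero.1 h1

/-! ### Inverses of metaplectic operators on Schwartz functions, and the Weyl symbol -/

variable [DecidableEq ι]

/-- The restriction to Schwartz functions is only known through its image in L², so the comparison
takes place there; the embedding into L² is injective. -/
lemma MetaplecticOperator.inv_inv_onSchwartz {A : Matrix.symplecticGroup ι ℝ}
    (U : MetaplecticOperator A) (f : 𝓢(E ι, ℂ)) : U.inv.inv.onSchwartz f = U.onSchwartz f :=
  toL2_injective <| (U.inv.inv.toL2_onSchwartz f).trans (U.toL2_onSchwartz f).symm

lemma MetaplecticOperator.inv_onSchwartz_onSchwartz {A : Matrix.symplecticGroup ι ℝ}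
    (U : MetaplecticOperator A) (f : 𝓢(E ι, ℂ)) : U.inv.onSchwartz (U.onSchwartz f) = f := by
  refine toL2_injective ?_
  rw [toL2_onSchwartz, toL2_onSchwartz]
  exact U.toIso.symm_apply_apply _

/-- The Weyl symbol of a metaplectic pseudodifferential operator. -/
theorem weylOp_onTempered {A : Matrix.symplecticGroup (ι ⊕ ι) ℝ} (U : MetaplecticOperator A)
    (b : 𝓢'(E (ι ⊕ ι), ℂ)) :
    weylOp ((wignerMetaplectic ι).onTempered (U.inv.onTempered b)) = metaOp U b := by
  refine ContinuousLinearMap.ext fun f => ext_bracket fun g => ?_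
  -- Both operators move to the test function as inverses: Â_{1/2}⁻¹ undoes W(g, f) = Â_{1/2}(g ⊗
  -- conj f), and the double inverse of Â is Â again, which gives W_A(g, f).
  rw [bracket_weylOp, bracket_metaOp, MetaplecticOperator.bracket_onTempered,
    MetaplecticOperator.bracket_onTempered, MetaplecticOperator.inv_inv_onSchwartz,
    ← metaWigner_wignerMetaplectic, metaWigner, metaWigner,
    MetaplecticOperator.inv_onSchwartz_onSchwartz]

end Uniqueness

end ALoc

end

/-- The localization operator is by definition the metaplectic operator with symbol a * W_A(φ₂, φ₁),
so the symbol formula for `metaOp` gives the first claim, and the injectivity of σ ↦ Op_w(σ) gives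
the second. -/
theorem proposition3 (d : ℕ) (A : Matrix.symplecticGroup (Fin d ⊕ Fin d) ℝ)
    (Â : ALoc.MetaplecticOperator A) (φ₁ φ₂ : 𝓢(ALoc.E (Fin d), ℂ))
    (a : 𝓢'(ALoc.E (Fin d ⊕ Fin d), ℂ)) :
    ALoc.weylOp ((ALoc.wignerMetaplectic (Fin d)).onTempered
        (Â.inv.onTempered (ALoc.conv a (ALoc.metaWigner Â φ₂ φ₁)))) =
      ALoc.locOp Â a φ₁ φ₂ ∧
    ∀ σ : 𝓢'(ALoc.E (Fin d ⊕ Fin d), ℂ), ALoc.weylOp σ = ALoc.locOp Â a φ₁ φ₂ →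
      σ = (ALoc.wignerMetaplectic (Fin d)).onTempered
        (Â.inv.onTempered (ALoc.conv a (ALoc.metaWigner Â φ₂ φ₁))) :=
  ⟨ALoc.weylOp_onTempered Â _, fun _ hσ =>
    ALoc.weylOp_injective (hσ.trans (ALoc.weylOp_onTempered Â _).symm)⟩
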